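/- Let $D\ge 4$, and let $f,g$ be positive $C^2$ functions on an open set $I\subset(0,\infty)$. Consider the $D$-dimensional static spacetime $M=\mathbb R\times I\times\Sigma$ with $$ds^2=-f(r)\,dt^2+g(r)\,dr^2+r^2\left(d\chi^2+s(\chi)^2\,d\Omega_{D-3}^2\right),$$ where $\Sigma$ is the unit sphere ($s=\sin\chi$), Euclidean space ($s=\chi$) or hyperbolic space ($s=\sinh\chi$) of dimension $D-2$, and $d\Omega^2_{D-3}$ is the metric of the unit $(D-3)$-sphere. For $r\in I$ let $S_r$ be the timelike hypersurface of constant radius $r$. It is a *photon surface* if for every $p\in S_r$ and every nonzero null vector $k\in T_pS_r$ there is a null geodesic $\gamma:(-\epsilon,\epsilon)\to M$ with $\gamma(0)=p$, $\dot\gamma(0)=k$ and $\gamma\subset S_r$. A null geodesic of constant radius $r$ (affinely parametrized, around the parameter $0$) is a *stable* orbit if for every $\epsilon>0$ there is a $\delta>0$ such that every null geodesic $\eta$ that starts with the same $t$, the same position in $\Sigma$ and the same $\Sigma$-component of the velocity, and whose $r(0)$, $\dot r(0)$, $\dot t(0)$ differ by less than $\delta$ from those of the orbit, satisfies $|r(\eta(\lambda))-r|<\epsilon$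 for all $\lambda\ge0$ for which it is defined; otherwise it is *unstable*. The photon surface $S_r$ is *unstable* if every null geodesic along it is an unstable orbit. A *stationary radiation-fluid flow* with the symmetry of the spacetime, over an open interval $J\subset I$ of radii, consists of a number density $n>0$, enthalpy per particle $h>0$, pressure $p$, temperature $T>0$, entropy per particle $\mathsf S$, and a future-directed 4-velocity $u=u^t\partial_t+u^r\partial_r$ with $g_{ab}u^au^b=-1$, where $n,h,p,T,\mathsf S,u^t,u^r$ are functions of $r\in J$ only, and all of them except possibly $T$ are differentiable (so that $|dn/dr|<\infty$, as required of a physical flow). They satisfy the first law $dh=T\,d\mathsf S+n^{-1}dp$, the conservation laws $\nabla_a(nu^a)=0$ and $\nabla_a(nhu^au_b+p\,\delta^a_b)=0$, and the radiation equation of state $h=K(\mathsf S)\,n^{\gamma-1}$ with some function $K$ and $\gamma=D/(D-1)$. Let $v^2$ be the squared 3-velocity of the flow measured by the static observer $u_o=f^{-1/2}\partial_t$, i.e. $1/(1-v^2)=(g_{ab}u^au_o^b)^2$, and let $v_s^2=\partial\ln h/\partial\ln n$ at fixed entropy be the squared sound speed. The flow is *transonic* if it has both subsonic ($v^2<v_s^2$)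 and supersonic ($v^2>v_s^2$) regions, and $r_s\in J$ is the radius of a *sonic point* if $v^2/v_s^2=1$ at $r_s$. **Theorem.** If $r_s$ is the radius of a sonic point of such a physical transonic flow, then $S_{r_s}$ is an unstable photon surface. Moreover $(fr^{-2})''(r_s)<0$ whenever $(fr^{-2})''(r_s)\neq0$. -/

import Mathlib

/-!
Static spacetimes `-f dt² + g dr² + r² (dχ² + s(χ)² dΩ²)` of dimension `D = m + 4`, their null
geodesics and constant-`r` photon surfaces, and stationary radial flows of radiation fluid.
-/

/-! ### Coordinate tensor calculus on `ℝ^N` -/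

/-- The partial derivative `∂_i F` at `y`. -/
noncomputable def coordDeriv {N : ℕ} (i : Fin N) (F : (Fin N → ℝ) → ℝ) (y : Fin N → ℝ) : ℝ :=
  deriv (fun x => F (Function.update y i x)) (y i)

/-- The Christoffel symbol `Γ^a_{bc}` of a metric `G`, given by its matrix in coordinates. -/
noncomputable def christoffel {N : ℕ} (G : (Fin N → ℝ) → Matrix (Fin N) (Fin N) ℝ)
    (y : Fin N → ℝ) (a b c : Fin N) : ℝ :=
  1 / 2 * ∑ d, (G y)⁻¹ a d *
    (coordDeriv b (fun z => G z d c) y + coordDeriv c (fun z => G z d b) y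
      - coordDeriv d (fun z => G z b c) y)

/-- The divergence `∇_a J^a` of a vector field. -/
noncomputable def divVector {N : ℕ} (G : (Fin N → ℝ) → Matrix (Fin N) (Fin N) ℝ)
    (J : (Fin N → ℝ) → Fin N → ℝ) (y : Fin N → ℝ) : ℝ :=
  ∑ a, (coordDeriv a (fun z => J z a) y + ∑ b, christoffel G y a a b * J y b)

/-- The divergence `∇_a T^a_b` of a tensor field of type `(1,1)`, where `T y a b` is `T^a_b`. -/
noncomputable def divTensor {N : ℕ} (G : (Fin N → ℝ) → Matrix (Fin N) (Fin N) ℝ)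
    (T : (Fin N → ℝ) → Fin N → Fin N → ℝ) (y : Fin N → ℝ) (b : Fin N) : ℝ :=
  ∑ a, (coordDeriv a (fun z => T z a b) y + ∑ c, christoffel G y a a c * T y c b
    - ∑ c, christoffel G y c a b * T y a c)

/-! ### The maximally symmetric spaces of dimension `m + 2` -/

/-- The three kinds of spatial symmetry. -/
inductive SpatialSymmetry
  | spherical
  | planar
  | hyperbolic

namespace SpatialSymmetry

/-- The function `s` of the line element `dχ² + s(χ)² dΩ²`. -/
noncomputable def s : SpatialSymmetry → ℝ → ℝ
  | spherical => Real.sin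
  | planar => fun χ => χ
  | hyperbolic => Real.sinh

/-- The companion `c` of `s`: the point at distance `χ` from `o` in the unit direction `v` is
`c(χ) o + s(χ) v`. -/
noncomputable def c : SpatialSymmetry → ℝ → ℝ
  | spherical => Real.cos
  | planar => fun _ => 1
  | hyperbolic => Real.cosh

/-- The range of the polar distance `χ`. -/
def chiRange : SpatialSymmetry → Set ℝ
  | spherical => Set.Ioo 0 Real.pi
  | planar => Set.Ioi 0
  | hyperbolic => Set.Ioi 0

/-- The ambient bilinear form: Minkowskian in the hyperbolic case, Euclidean otherwise. -/
def form (σ : SpatialSymmetry) {m : ℕ} (v w : Fin (m + 3) → ℝ) : ℝ :=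
  (match σ with
    | spherical => 1
    | planar => 1
    | hyperbolic => -1) * (v 0 * w 0) + ∑ i : Fin (m + 2), v i.succ * w i.succ

/-- The complete model space: the unit sphere, the affine hyperplane `X₀ = 1`, or the upper sheet
of the unit hyperboloid. -/
def space (σ : SpatialSymmetry) (m : ℕ) : Set (Fin (m + 3) → ℝ) :=
  match σ with
  | spherical => {X | spherical.form X X = 1}
  | planar => {X | X 0 = 1}
  | hyperbolic => {X | hyperbolic.form X X = -1 ∧ 0 < X 0}

/-- The tangent space of the model space at `X`; its Riemannian metric is the restriction of
`form`. -/
def tangent (σ : SpatialSymmetry) {m : ℕ} (X : Fin (m + 3) → ℝ) : Set (Fin (m + 3) → ℝ) :=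
  match σ with
  | spherical => {v | spherical.form X v = 0}
  | planar => {v | v 0 = 0}
  | hyperbolic => {v | hyperbolic.form X v = 0}

/-- A point `o` of the model space with an orthonormal basis `e` of the tangent space there. -/
structure IsFrame (σ : SpatialSymmetry) {m : ℕ} (o : Fin (m + 3) → ℝ)
    (e : Fin (m + 2) → Fin (m + 3) → ℝ) : Prop where
  mem : o ∈ σ.space m
  tangent : ∀ i, e i ∈ σ.tangent o
  orthonormal : ∀ i j, σ.form (e i) (e j) = if i = j then 1 else 0

end SpatialSymmetry

/-- The point of the unit sphere in `ℝ^(m+2)` with angles `θ`, that is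
`(cos θ₁, sin θ₁ cos θ₂, …, sin θ₁ ⋯ sin θ_m cos θ_{m+1}, sin θ₁ ⋯ sin θ_m sin θ_{m+1})`. -/
noncomputable def sphereVector {m : ℕ} (θ : Fin (m + 1) → ℝ) (j : Fin (m + 2)) : ℝ :=
  (∏ i ∈ Finset.univ.filter (fun i : Fin (m + 1) => i.val < j.val), Real.sin (θ i)) *
    (if h : j.val < m + 1 then Real.cos (θ ⟨j.val, h⟩) else 1)

/-! ### The spacetime -/

/-- The data of a static spacetime of dimension `m + 4`: the kind of symmetry, the open set of
radii, and the positive metric functions. -/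
structure StaticSpacetime (m : ℕ) where
  sym : SpatialSymmetry
  radii : Set ℝ
  f : ℝ → ℝ
  g : ℝ → ℝ
  isOpen_radii : IsOpen radii
  radii_pos : ∀ r ∈ radii, 0 < r
  f_pos : ∀ r ∈ radii, 0 < f r
  g_pos : ∀ r ∈ radii, 0 < g r
  f_smooth : ContDiffOn ℝ 2 f radii
  g_smooth : ContDiffOn ℝ 2 g radii

/-- Triples `(t, r, X)`; the points of the spacetime are those with `r` in the set of radii and `X`
in the model space. The same type holds their tangent vectors `(k^t, k^r, K)`. -/
abbrev STPoint (m : ℕ) : Type := ℝ × ℝ × (Fin (m + 3) → ℝ)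

namespace StaticSpacetime

variable {m : ℕ} (M : StaticSpacetime m)

/-- The metric in the coordinates `(t, r, χ, θ₁, …, θ_{m+1})`: the diagonal matrix with entries
`-f`, `g`, `r²`, and `r² s(χ)² sin² θ₁ ⋯ sin² θ_{i-1}` for `θ_i`. -/
noncomputable def metric (y : Fin (m + 4) → ℝ) : Matrix (Fin (m + 4)) (Fin (m + 4)) ℝ :=
  Matrix.diagonal
    (Fin.cons (-M.f (y 1)) (Fin.cons (M.g (y 1)) (Fin.cons ((y 1) ^ 2)
      (fun i : Fin (m + 1) => (y 1) ^ 2 * (M.sym.s (y 2) ^ 2 *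
        ∏ j ∈ Finset.univ.filter (fun j : Fin (m + 1) => j < i),
          Real.sin (y j.succ.succ.succ) ^ 2)))) : Fin (m + 4) → ℝ)

/-- The domain of the polar coordinates. The last angle runs through the whole line. -/
def coordDomain : Set (Fin (m + 4) → ℝ) :=
  {y | y 1 ∈ M.radii ∧ y 2 ∈ M.sym.chiRange ∧
    ∀ i : Fin m, y i.castSucc.succ.succ.succ ∈ Set.Ioo 0 Real.pi}

/-- The point with given polar coordinates around `o`, with respect to the orthonormal basis `e`
of the tangent space of the model space at `o`. As `(o, e)` varies, these local parametrizations
cover the spacetime, and the metric has the same form in each of them. -/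
noncomputable def polar (o : Fin (m + 3) → ℝ) (e : Fin (m + 2) → Fin (m + 3) → ℝ)
    (y : Fin (m + 4) → ℝ) : STPoint m :=
  (y 0, y 1, M.sym.c (y 2) • o +
    M.sym.s (y 2) • ∑ j, sphereVector (fun i : Fin (m + 1) => y i.succ.succ.succ) j • e j)

/-- `γ` is an affinely parametrized null geodesic on the open interval `(a, b)`: around each
parameter, in some polar coordinates, `y'' ^ i + Γ^i_{jk} y' ^ j y' ^ k = 0`, and `y'` is a nonzero
null vector. -/
def IsNullGeodesic (γ : ℝ → STPoint m) (a b : ℝ) : Prop :=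
  ∀ τ₀ ∈ Set.Ioo a b, ∃ (o : Fin (m + 3) → ℝ) (e : Fin (m + 2) → Fin (m + 3) → ℝ)
    (y v : ℝ → Fin (m + 4) → ℝ), M.sym.IsFrame o e ∧
      ∀ᶠ τ in nhds τ₀, y τ ∈ M.coordDomain ∧ γ τ = M.polar o e (y τ) ∧
        HasDerivAt y (v τ) τ ∧
        HasDerivAt v (fun i => -∑ j, ∑ k, christoffel M.metric (y τ) i j k * v τ j * v τ k) τ ∧
        v τ ≠ 0 ∧ ∑ i, ∑ j, M.metric (y τ) i j * v τ i * v τ j = 0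

/-- The square `-f (k^t)² + g (k^r)² + r² |K|²` of a tangent vector `k = (k^t, k^r, K)` at a point
of radius `r`. -/
def normSq (r : ℝ) (k : STPoint m) : ℝ :=
  -M.f r * k.1 ^ 2 + M.g r * k.2.1 ^ 2 + r ^ 2 * M.sym.form k.2.2 k.2.2

/-- The timelike hypersurface `S_r` of constant radius `r` is a photon surface: from each of its
points, in each null direction tangent to it, there starts a null geodesic that stays in it. -/
def IsPhotonSurface (r : ℝ) : Prop :=
  r ∈ M.radii ∧ ∀ (t : ℝ), ∀ X ∈ M.sym.space m, ∀ k : STPoint m,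
    k.2.1 = 0 → k.2.2 ∈ M.sym.tangent X → k ≠ 0 → M.normSq r k = 0 →
      ∃ ε > 0, ∃ γ : ℝ → STPoint m, M.IsNullGeodesic γ (-ε) ε ∧ γ 0 = (t, r, X) ∧
        HasDerivAt γ k 0 ∧ ∀ τ ∈ Set.Ioo (-ε) ε, (γ τ).2.1 = r

/-- A null geodesic `γ` around the parameter `0`, of constant radius, is a stable orbit: null
geodesics with the same starting point and velocity up to small changes of the radius and of the
radial velocity (and the change of `dt/dτ` that keeps the velocity null) stay close in radius. -/
def IsStableOrbit (γ : ℝ → STPoint m) : Prop :=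
  ∀ ε > 0, ∃ δ > 0, ∀ (η : ℝ → STPoint m) (a b : ℝ), a < 0 → 0 < b → M.IsNullGeodesic η a b →
    (η 0).1 = (γ 0).1 → (η 0).2.2 = (γ 0).2.2 → (deriv η 0).2.2 = (deriv γ 0).2.2 →
    |(η 0).2.1 - (γ 0).2.1| < δ → |(deriv η 0).2.1 - (deriv γ 0).2.1| < δ →
    |(deriv η 0).1 - (deriv γ 0).1| < δ →
      ∀ τ ∈ Set.Ico 0 b, |(η τ).2.1 - (γ 0).2.1| < ε

/-- `S_r` is an unstable photon surface: a photon surface such that no null geodesic along it is a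
stable orbit. -/
def IsUnstablePhotonSurface (r : ℝ) : Prop :=
  M.IsPhotonSurface r ∧ ∀ (γ : ℝ → STPoint m) (a b : ℝ), a < 0 → 0 < b →
    M.IsNullGeodesic γ a b → (∀ τ ∈ Set.Ioo a b, (γ τ).2.1 = r) → ¬ M.IsStableOrbit γ

end StaticSpacetime

/-! ### The fluid -/

/-- The radiation enthalpy per particle as a function of the number density: `K n^(γ - 1)` with
`γ = (d + 1) / d`, where `d = m + 3` is the number of spatial dimensions. -/
noncomputable def radiationEnthalpy (m : ℕ) (K n : ℝ) : ℝ :=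
  K * n ^ (((m + 3 : ℝ) + 1) / (m + 3 : ℝ) - 1)

/-- The squared sound speed `∂ ln h / ∂ ln n` of the enthalpy function `h`, at the density `n`. -/
noncomputable def soundSpeedSq (h : ℝ → ℝ) (n : ℝ) : ℝ :=
  deriv (fun x => Real.log (h (Real.exp x))) (Real.log n)

/-- The vector field `u^t ∂_t + u^r ∂_r`, with components that depend on the radius only. -/
def radialField {m : ℕ} (ut ur : ℝ → ℝ) (y : Fin (m + 4) → ℝ) : Fin (m + 4) → ℝ :=
  Fin.cons (ut (y 1)) (Fin.cons (ur (y 1)) (fun _ => 0))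

/-- The energy-momentum tensor `T^a_b = n h u^a u_b + p δ^a_b` of a perfect fluid. -/
noncomputable def StaticSpacetime.stress {m : ℕ} (M : StaticSpacetime m) (n h p ut ur : ℝ → ℝ)
    (y : Fin (m + 4) → ℝ) (a b : Fin (m + 4)) : ℝ :=
  n (y 1) * h (y 1) * radialField ut ur y a * (∑ c, M.metric y b c * radialField ut ur y c)
    + p (y 1) * (if a = b then 1 else 0)

/-- A stationary radial flow of radiation fluid with the symmetry of the spacetime, over an open
interval of radii: number density `n`, enthalpy per particle `h`, pressure `p`, temperature `T`,
entropy per particle `S`, and the components `ut`, `ur` of the 4-velocity, all differentiable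
functions of the radius (so the density gradient is finite). At entropy `S` the enthalpy is
`K S * n^(γ - 1)`. -/
structure RadiationFlow {m : ℕ} (M : StaticSpacetime m) where
  dom : Set ℝ
  isOpen_dom : IsOpen dom
  ordConnected_dom : dom.OrdConnected
  dom_subset : dom ⊆ M.radii
  n : ℝ → ℝ
  h : ℝ → ℝ
  p : ℝ → ℝ
  T : ℝ → ℝ
  S : ℝ → ℝ
  K : ℝ → ℝ
  ut : ℝ → ℝ
  ur : ℝ → ℝ
  n_diff : DifferentiableOn ℝ n dom
  h_diff : DifferentiableOn ℝ h dom
  p_diff : DifferentiableOn ℝ p dom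
  S_diff : DifferentiableOn ℝ S dom
  ut_diff : DifferentiableOn ℝ ut dom
  ur_diff : DifferentiableOn ℝ ur dom
  n_pos : ∀ r ∈ dom, 0 < n r
  h_pos : ∀ r ∈ dom, 0 < h r
  T_pos : ∀ r ∈ dom, 0 < T r
  ut_pos : ∀ r ∈ dom, 0 < ut r
  /-- `g(u, u) = -1` -/
  normalized : ∀ r ∈ dom, -M.f r * ut r ^ 2 + M.g r * ur r ^ 2 = -1
  /-- The equation of state. -/
  eos : ∀ r ∈ dom, h r = radiationEnthalpy m (K (S r)) (n r)
  /-- `dh = T dS + n⁻¹ dp` -/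
  first_law : ∀ r ∈ dom, deriv h r = T r * deriv S r + (n r)⁻¹ * deriv p r
  /-- `∇_a (n u^a) = 0` -/
  continuity_eq : ∀ y ∈ M.coordDomain, y 1 ∈ dom →
    divVector M.metric (fun z a => n (z 1) * radialField ut ur z a) y = 0
  /-- `∇_a T^a_b = 0` -/
  conservation : ∀ y ∈ M.coordDomain, y 1 ∈ dom →
    ∀ b, divTensor M.metric (M.stress n h p ut ur) y b = 0

namespace RadiationFlow

variable {m : ℕ} {M : StaticSpacetime m} (Φ : RadiationFlow M)

/-- The squared 3-velocity `v²` measured by the static observer `u_o = f^(-1/2) ∂_t`, so that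
`1 / (1 - v²) = g(u, u_o)²`. -/
noncomputable def velocitySq (r : ℝ) : ℝ :=
  1 - 1 / (-M.f r * Φ.ut r * (1 / Real.sqrt (M.f r))) ^ 2

/-- The squared sound speed of the fluid at radius `r`. -/
noncomputable def soundSq (r : ℝ) : ℝ :=
  soundSpeedSq (radiationEnthalpy m (Φ.K (Φ.S r))) (Φ.n r)

/-- The flow is transonic: it has both subsonic and supersonic regions. -/
def IsTransonic : Prop :=
  (∃ r ∈ Φ.dom, Φ.velocitySq r < Φ.soundSq r) ∧ ∃ r ∈ Φ.dom, Φ.soundSq r < Φ.velocitySq r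

/-- `r` is the radius of a sonic point. -/
def IsSonicRadius (r : ℝ) : Prop :=
  r ∈ Φ.dom ∧ Φ.velocitySq r / Φ.soundSq r = 1

end RadiationFlow

/-! A null geodesic with energy `E` and angular momentum `L` satisfies `f g r'² = E² - L² f / r²`,
so `f / r²` is the potential for the radial motion of light. The theorem follows once `f / r²` is
known to be maximal at the sonic radius.

The fluid provides this. Write `w = f (u^t)²` for the squared Lorentz factor seen by static
observers and `N = m + 3` for the number of spatial dimensions. The particle flux is conserved
(`flux_sq_const`). Where matter flows, the energy per particle `h f u^t` is constant
(`deriv_energy`), and so is the entropy (`deriv_S`). Since `h^N` is proportional to `n` at fixed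
entropy, eliminating `n` and `h` makes `(f / r²)^(N - 1)` a constant multiple of `(w - 1) / w^N`.
That function of `w` has its maximum at `w = N / (N - 1)` (`sub_one_mul_pow_le`), which says `v² = 1
/ N`, the squared sound speed. Hence `f / r²` is maximal over the whole flow at a sonic point
(`IsSonicRadius.isMax`), whatever the profile of `w`.

At a critical point of `f / r²` the circular null orbits are geodesics
(`isPhotonSurface_of_deriv_eq_zero`). At a local maximum, even a degenerate one, a slight increase
of the energy keeps `r'²` positive on a fixed interval of radii, so the perturbed ray crosses it
(`exists_escaping_geodesic`, `not_isStableOrbit_of_isLocalMax`). The second derivative is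
nonpositive at a maximum. -/

namespace SpatialSymmetry

/-- The curvature of the model space. -/
def curv : SpatialSymmetry → ℝ
  | spherical => 1
  | planar => 0
  | hyperbolic => -1

/-! ### Generalized trigonometry of the three model spaces. -/

variable (σ : SpatialSymmetry) {m : ℕ}

lemma hasDerivAt_s (χ : ℝ) : HasDerivAt σ.s (σ.c χ) χ := by
  cases σ
  · exact Real.hasDerivAt_sin χ
  · exact hasDerivAt_id χ
  · exact Real.hasDerivAt_sinh χ

lemma hasDerivAt_c (χ : ℝ) : HasDerivAt σ.c (-σ.curv * σ.s χ) χ := by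
  cases σ
  · simpa [c, s, curv] using Real.hasDerivAt_cos χ
  · simpa [c, s, curv] using hasDerivAt_const χ (1 : ℝ)
  · simpa [c, s, curv] using Real.hasDerivAt_cosh χ

lemma c_sq_add (χ : ℝ) : σ.c χ ^ 2 + σ.curv * σ.s χ ^ 2 = 1 := by
  cases σ
  · simp [c, s, curv]
  · simp [c, s, curv]
  · simp only [c, s, curv]; linarith [Real.cosh_sq χ]

lemma s_add (x y : ℝ) : σ.s (x + y) = σ.s x * σ.c y + σ.c x * σ.s y := by
  cases σ
  · exact Real.sin_add x y
  · simp [c, s]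
  · exact Real.sinh_add x y

lemma c_add (x y : ℝ) : σ.c (x + y) = σ.c x * σ.c y - σ.curv * (σ.s x * σ.s y) := by
  cases σ
  · simpa [c, s, curv] using Real.cos_add x y
  · simp [c, curv]
  · simpa [c, s, curv] using Real.cosh_add x y

@[simp] lemma s_zero : σ.s 0 = 0 := by cases σ <;> simp [s]

@[simp] lemma c_zero : σ.c 0 = 1 := by cases σ <;> simp [c]

lemma s_ne_zero {χ : ℝ} (h : χ ∈ σ.chiRange) : σ.s χ ≠ 0 := by
  cases σ
  · exact (Real.sin_pos_of_mem_Ioo h).ne'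
  · exact ne_of_gt h
  · exact (Real.sinh_pos_iff.2 h).ne'

lemma isOpen_chiRange : IsOpen σ.chiRange := by
  cases σ
  · exact isOpen_Ioo
  · exact isOpen_Ioi
  · exact isOpen_Ioi

lemma one_mem_chiRange : (1 : ℝ) ∈ σ.chiRange := by
  cases σ
  · exact ⟨one_pos, by linarith [Real.pi_gt_three]⟩
  · exact zero_lt_one' ℝ
  · exact zero_lt_one' ℝ

/-! ### The ambient form, tangent spaces and geodesics of the model spaces. -/

/-- The ambient form as a bilinear map. -/
def formBilin (m : ℕ) : (Fin (m + 3) → ℝ) →ₗ[ℝ] (Fin (m + 3) → ℝ) →ₗ[ℝ] ℝ :=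
  LinearMap.mk₂ ℝ σ.form
    (fun x y z => by simp [form, add_mul, Finset.sum_add_distrib]; ring)
    (fun a x z => by simp [form, mul_assoc, Finset.mul_sum, mul_add]; ring)
    (fun x y z => by simp [form, mul_add, Finset.sum_add_distrib]; ring)
    (fun a x z => by simp [form, Finset.mul_sum, mul_add, mul_left_comm])

lemma formBilin_apply (v w : Fin (m + 3) → ℝ) : σ.formBilin m v w = σ.form v w := rfl

lemma form_comm (v w : Fin (m + 3) → ℝ) : σ.form v w = σ.form w v := by
  simp [form, mul_comm]

lemma form_add_left (u v w : Fin (m + 3) → ℝ) : σ.form (u + v) w = σ.form u w + σ.form v w := by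
  simp [← formBilin_apply]

lemma form_add_right (u v w : Fin (m + 3) → ℝ) : σ.form w (u + v) = σ.form w u + σ.form w v := by
  simp [← formBilin_apply]

lemma form_smul_left (a : ℝ) (v w : Fin (m + 3) → ℝ) : σ.form (a • v) w = a * σ.form v w := by
  simp [← formBilin_apply]

lemma form_smul_right (a : ℝ) (v w : Fin (m + 3) → ℝ) : σ.form v (a • w) = a * σ.form v w := by
  simp [← formBilin_apply]

/-- The linear functional whose kernel is the tangent space at `X`. -/
def normal (X : Fin (m + 3) → ℝ) : (Fin (m + 3) → ℝ) →ₗ[ℝ] ℝ :=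
  match σ with
  | spherical => spherical.formBilin m X
  | planar => LinearMap.proj 0
  | hyperbolic => hyperbolic.formBilin m X

lemma mem_tangent_iff {X v : Fin (m + 3) → ℝ} : v ∈ σ.tangent X ↔ v ∈ (σ.normal X).ker := by
  cases σ <;> rfl

variable {σ} {X U o : Fin (m + 3) → ℝ}

/-- The factor `σ.curv` allows one formula for all three cases: in the planar case `form X X` is not
normalized, but it only ever occurs with coefficient zero. -/
lemma curv_mul_form_self (hX : X ∈ σ.space m) : σ.curv * σ.form X X = σ.curv ^ 2 := by
  cases σ
  · simp [curv, show spherical.form X X = 1 from hX]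
  · simp [curv]
  · simp [curv, hX.1]

lemma curv_mul_form_tangent (hU : U ∈ σ.tangent X) : σ.curv * σ.form X U = 0 := by
  cases σ
  · simp [show spherical.form X U = 0 from hU]
  · simp [curv]
  · simp [show hyperbolic.form X U = 0 from hU]

lemma normal_self_ne_zero (hX : X ∈ σ.space m) : σ.normal X X ≠ 0 := by
  cases σ
  · change spherical.form X X ≠ 0
    rw [show spherical.form X X = 1 from hX]; simp
  · change X 0 ≠ 0
    rw [show X 0 = 1 from hX]; simp
  · change hyperbolic.form X X ≠ 0
    rw [hX.1]; simp

lemma finrank_ker_normal (hX : X ∈ σ.space m) :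
    Module.finrank ℝ (σ.normal X).ker = m + 2 := by
  have hne : σ.normal X ≠ 0 := fun h => normal_self_ne_zero hX (by simp [h])
  have := Module.Dual.finrank_ker_add_one_of_ne_zero (f := σ.normal X) hne
  simp at this
  omega

/-- Cauchy–Schwarz for the spatial parts, whose product is `X 0 * v 0` by tangency. It yields
positivity of the form on tangent vectors and keeps geodesics on the upper sheet. -/
lemma hyperbolic_sq_zero_le {v : Fin (m + 3) → ℝ} (hX : X ∈ hyperbolic.space m)
    (hv : v ∈ hyperbolic.tangent X) : v 0 ^ 2 ≤ (X 0 ^ 2 - 1) * hyperbolic.form v v := by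
  have h1 : -(X 0 * X 0) + ∑ i : Fin (m + 2), X i.succ * X i.succ = -1 := by
    simpa [form] using hX.1
  have h2 : -(X 0 * v 0) + ∑ i : Fin (m + 2), X i.succ * v i.succ = 0 := by
    have : hyperbolic.form X v = 0 := hv
    simpa [form] using this
  have h3 : hyperbolic.form v v = -(v 0 * v 0) + ∑ i : Fin (m + 2), v i.succ * v i.succ := by
    simp [form]
  have h4 := Finset.sum_mul_sq_le_sq_mul_sq Finset.univ
    (fun i : Fin (m + 2) => X i.succ) (fun i => v i.succ)
  simp only [pow_two] at h4
  rw [h3]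
  have e1 : ∑ i : Fin (m + 2), X i.succ * X i.succ = X 0 * X 0 - 1 := by linarith
  have e2 : ∑ i : Fin (m + 2), X i.succ * v i.succ = X 0 * v 0 := by linarith
  rw [e1, e2] at h4
  nlinarith

lemma form_self_pos {v : Fin (m + 3) → ℝ} (hX : X ∈ σ.space m) (hv : v ∈ σ.tangent X)
    (h0 : v ≠ 0) : 0 < σ.form v v := by
  have key : (v 0 ≠ 0 ∨ ∃ i : Fin (m + 2), v i.succ ≠ 0) := by
    by_contra! h
    exact h0 (funext fun i => Fin.cases h.1 h.2 i)
  have hs : 0 ≤ ∑ i : Fin (m + 2), v i.succ * v i.succ :=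
    Finset.sum_nonneg fun i _ => mul_self_nonneg _
  have hp : (∃ i : Fin (m + 2), v i.succ ≠ 0) → 0 < ∑ i : Fin (m + 2), v i.succ * v i.succ := by
    rintro ⟨i, hi⟩
    exact Finset.sum_pos' (fun i _ => mul_self_nonneg _) ⟨i, Finset.mem_univ _, mul_self_pos.2 hi⟩
  cases σ
  · simp only [form, one_mul]
    rcases key with h | h
    · have := mul_self_pos.2 h; linarith
    · have := hp h; nlinarith [mul_self_nonneg (v 0)]
  · have h00 : v 0 = 0 := hv
    simp only [form, h00]
    rcases key with h | h
    · exact absurd h00 h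
    · have := hp h; linarith
  · have h1 := hyperbolic_sq_zero_le hX hv
    have hX1 : -(X 0 * X 0) + ∑ i : Fin (m + 2), X i.succ * X i.succ = -1 := by
      simpa [form] using hX.1
    have hX2 : 0 ≤ ∑ i : Fin (m + 2), X i.succ * X i.succ :=
      Finset.sum_nonneg fun i _ => mul_self_nonneg _
    have hX3 : 0 ≤ X 0 ^ 2 - 1 := by nlinarith
    by_contra! hneg
    have h00 : v 0 = 0 := by
      have : v 0 ^ 2 ≤ 0 := h1.trans (mul_nonpos_of_nonneg_of_nonpos hX3 hneg)
      exact pow_eq_zero_iff (two_ne_zero) |>.1 (le_antisymm this (sq_nonneg _))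
    simp only [form, h00] at hneg
    rcases key with h | h
    · exact h h00
    · have := hp h; linarith

/-- This curve is the unit-speed geodesic from `X` in direction `U`. In the hyperbolic case `|U 0| <
X 0` and `|sinh| < cosh` keep the zeroth coordinate positive. -/
lemma add_smul_mem_space (hX : X ∈ σ.space m) (hU : U ∈ σ.tangent X) (h1 : σ.form U U = 1)
    (φ : ℝ) : σ.c φ • X + σ.s φ • U ∈ σ.space m := by
  have hc := σ.c_sq_add φ
  cases σ
  · have a : spherical.form X X = 1 := hX
    have b : spherical.form X U = 0 := hU
    have b' : spherical.form U X = 0 := by rw [form_comm]; exact b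
    change spherical.form _ _ = 1
    simp only [form_add_left, form_add_right, form_smul_left, form_smul_right, a, b, b', h1]
    simp only [curv] at hc
    linear_combination hc
  · have a : X 0 = 1 := hX
    have b : U 0 = 0 := hU
    change (_ : Fin (m + 3) → ℝ) 0 = 1
    simp [a, b, c]
  · have a : hyperbolic.form X X = -1 := hX.1
    have b : hyperbolic.form X U = 0 := hU
    have b' : hyperbolic.form U X = 0 := by rw [form_comm]; exact b
    refine ⟨?_, ?_⟩
    · simp only [form_add_left, form_add_right, form_smul_left, form_smul_right, a, b, b', h1]
      simp only [curv] at hc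
      linear_combination -hc
    · have h2 := hyperbolic_sq_zero_le hX hU
      rw [h1] at h2
      have hX0 : 0 < X 0 := hX.2
      have hlt : |U 0| < X 0 := abs_lt_of_sq_lt_sq (by linarith) hX0.le
      have hlt' : |Real.sinh φ| < Real.cosh φ :=
        abs_lt_of_sq_lt_sq (by linarith [Real.cosh_sq φ]) (Real.cosh_pos φ).le
      have : |Real.sinh φ * U 0| < Real.cosh φ * X 0 := by
        rw [abs_mul]
        exact mul_lt_mul'' hlt' hlt (abs_nonneg _) (abs_nonneg _)
      have := (abs_lt.1 this).1
      simp only [c, s, Pi.add_apply, Pi.smul_apply, smul_eq_mul]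
      linarith

lemma add_smul_mem_tangent (hX : X ∈ σ.space m) (hU : U ∈ σ.tangent X) (h1 : σ.form U U = 1)
    (φ : ℝ) : (-σ.curv * σ.s φ) • X + σ.c φ • U ∈ σ.tangent (σ.c φ • X + σ.s φ • U) := by
  cases σ
  · have a : spherical.form X X = 1 := hX
    have b : spherical.form X U = 0 := hU
    have b' : spherical.form U X = 0 := by rw [form_comm]; exact b
    change spherical.form _ _ = 0
    simp only [form_add_left, form_add_right, form_smul_left, form_smul_right, a, b, b', h1, curv]
    ring
  · have b : U 0 = 0 := hU
    change (_ : Fin (m + 3) → ℝ) 0 = 0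
    simp [b, curv]
  · have a : hyperbolic.form X X = -1 := hX.1
    have b : hyperbolic.form X U = 0 := hU
    have b' : hyperbolic.form U X = 0 := by rw [form_comm]; exact b
    change hyperbolic.form _ _ = 0
    simp only [form_add_left, form_add_right, form_smul_left, form_smul_right, a, b, b', h1, curv]
    ring

/-- Used for the angular directions: they are orthogonal to the radial geodesic and stay tangent
along it. -/
lemma mem_tangent_add_smul {z : Fin (m + 3) → ℝ} (hz : z ∈ σ.tangent X) (h : σ.form U z = 0)
    (a b : ℝ) : z ∈ σ.tangent (a • X + b • U) := by
  cases σ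
  · have hz : spherical.form X z = 0 := hz
    change spherical.form _ _ = 0
    simp [form_add_left, form_smul_left, hz, h]
  · exact hz
  · have hz : hyperbolic.form X z = 0 := hz
    change hyperbolic.form _ _ = 0
    simp [form_add_left, form_smul_left, hz, h]

lemma form_velocity_tangent {z : Fin (m + 3) → ℝ} (hz : z ∈ σ.tangent X) (h : σ.form U z = 0)
    (φ : ℝ) : σ.form ((-σ.curv * σ.s φ) • X + σ.c φ • U) z = 0 := by
  rw [form_add_left, form_smul_left, form_smul_left, h]
  linear_combination (-σ.s φ) * curv_mul_form_tangent hz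

lemma form_velocity_self (hX : X ∈ σ.space m) (hU : U ∈ σ.tangent X) (h1 : σ.form U U = 1)
    (φ : ℝ) : σ.form ((-σ.curv * σ.s φ) • X + σ.c φ • U)
      ((-σ.curv * σ.s φ) • X + σ.c φ • U) = 1 := by
  simp only [form_add_left, form_add_right, form_smul_left, form_smul_right, h1,
    σ.form_comm U X]
  linear_combination σ.curv * σ.s φ ^ 2 * curv_mul_form_self hX
    - 2 * σ.s φ * σ.c φ * curv_mul_form_tangent hU + σ.c_sq_add φ
      + (by cases σ <;> simp only [curv] <;> ring :
        σ.curv ^ 3 * σ.s φ ^ 2 - σ.curv * σ.s φ ^ 2 = 0)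

/-- Moves the base point along the geodesic, so that polar coordinates can be centred away from a
given point of it. -/
lemma add_smul_add (X U : Fin (m + 3) → ℝ) (x y : ℝ) :
    σ.c (x + y) • X + σ.s (x + y) • U
      = σ.c y • (σ.c x • X + σ.s x • U) + σ.s y • ((-σ.curv * σ.s x) • X + σ.c x • U) := by
  ext i
  simp only [Pi.add_apply, Pi.smul_apply, smul_eq_mul, c_add, s_add]
  ring

lemma hasDerivAt_add_smul (X U : Fin (m + 3) → ℝ) {φ : ℝ → ℝ} {φ' τ : ℝ}
    (h : HasDerivAt φ φ' τ) : HasDerivAt (fun τ => σ.c (φ τ) • X + σ.s (φ τ) • U)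
      (φ' • ((-σ.curv * σ.s (φ τ)) • X + σ.c (φ τ) • U)) τ := by
  refine ((((σ.hasDerivAt_c (φ τ)).comp τ h).smul_const X).add
    (((σ.hasDerivAt_s (φ τ)).comp τ h).smul_const U)).congr_deriv ?_
  simp only [smul_add, smul_smul]
  congr 2 <;> ring

end SpatialSymmetry

/-! ### Frames with a prescribed direction. -/

/-- A unit vector of a finite-dimensional Euclidean space is the last vector of an orthonormal
basis. -/
lemma exists_orthonormal_last {V : Type*} [AddCommGroup V] [Module ℝ V] [FiniteDimensional ℝ V]
    (B : V →ₗ[ℝ] V →ₗ[ℝ] ℝ) (symm : ∀ v w, B v w = B w v) (pos : ∀ v, v ≠ 0 → 0 < B v v) {N : ℕ}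
    (hN : Module.finrank ℝ V = N + 1) (u : V) (hu : B u u = 1) :
    ∃ e : Fin (N + 1) → V, (∀ i j, B (e i) (e j) = if i = j then 1 else 0) ∧
      e (Fin.last N) = u := by
  let core : InnerProductSpace.Core ℝ V :=
    { inner := fun v w => B v w
      conj_inner_symm := fun v w => symm w v
      re_inner_nonneg := fun v => by
        by_cases h : v = 0
        · simp [h]
        · exact (pos v h).le
      add_left := fun u v w => by simp
      smul_left := fun u v a => by simp
      definite := fun v h => by
        by_contra h0
        exact (pos v h0).ne' h }
  let : NormedAddCommGroup V := core.toNormedAddCommGroup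
  let : InnerProductSpace ℝ V := InnerProductSpace.ofCore core.toCore
  have hinner : ∀ v w : V, inner ℝ v w = B v w := fun v w => rfl
  have hv : Orthonormal ℝ (({Fin.last N} : Set (Fin (N + 1))).domRestrict (fun _ => u)) := by
    rw [orthonormal_iff_ite]
    rintro ⟨i, hi⟩ ⟨j, hj⟩
    simp only [Set.mem_singleton_iff] at hi hj
    subst hi hj
    simpa using (hinner u u).trans hu
  obtain ⟨b, hb⟩ := hv.exists_orthonormalBasis_extension_of_card_eq (by simp [hN])
  refine ⟨b, fun i j => ?_, hb _ rfl⟩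
  rw [← hinner]
  exact orthonormal_iff_ite.1 b.orthonormal i j

lemma SpatialSymmetry.exists_frame {σ : SpatialSymmetry} {m : ℕ} {X U : Fin (m + 3) → ℝ}
    (hX : X ∈ σ.space m) (hU : U ∈ σ.tangent X) (h1 : σ.form U U = 1) :
    ∃ e, σ.IsFrame X e ∧ e (Fin.last (m + 1)) = U := by
  obtain ⟨e, he, hl⟩ := exists_orthonormal_last
    (((σ.formBilin m).domRestrict (σ.normal X).ker).compl₁₂ LinearMap.id
      (σ.normal X).ker.subtype)
    (fun v w => σ.form_comm _ _)
    (fun v hv => form_self_pos hX (σ.mem_tangent_iff.2 v.2) (by simpa using hv))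
    (finrank_ker_normal hX) ⟨U, σ.mem_tangent_iff.1 hU⟩ h1
  exact ⟨fun i => e i, ⟨hX, fun i => σ.mem_tangent_iff.2 (e i).2, fun i j => he i j⟩, by simp [hl]⟩

/-! ### Christoffel symbols of the diagonal metric. -/

section CoordDeriv

variable {N : ℕ}

@[simp] lemma coordDeriv_const (i : Fin N) (c : ℝ) (y : Fin N → ℝ) :
    coordDeriv i (fun _ => c) y = 0 := by
  simp [coordDeriv]

lemma coordDeriv_comp (i j : Fin N) (φ : ℝ → ℝ) (y : Fin N → ℝ) :
    coordDeriv i (fun z => φ (z j)) y = if i = j then deriv φ (y j) else 0 := by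
  unfold coordDeriv
  split_ifs with h
  · subst h; simp
  · simp [Function.update_of_ne (Ne.symm h)]

/-- The Christoffel symbols of a diagonal metric. -/
lemma christoffel_diagonal (E : (Fin N → ℝ) → Fin N → ℝ) (y : Fin N → ℝ) (hE : ∀ i, E y i ≠ 0)
    (a b c : Fin N) :
    christoffel (fun z => Matrix.diagonal (E z)) y a b c = 1 / 2 * ((E y a)⁻¹ *
      ((if a = c then coordDeriv b (fun z => E z a) y else 0)
        + (if a = b then coordDeriv c (fun z => E z a) y else 0)
        - (if b = c then coordDeriv a (fun z => E z b) y else 0))) := by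
  have hinv : (Matrix.diagonal (E y))⁻¹ = Matrix.diagonal (fun i => (E y i)⁻¹) := by
    apply Matrix.inv_eq_right_inv
    rw [Matrix.diagonal_mul_diagonal, ← Matrix.diagonal_one]
    congr 1
    ext i
    exact mul_inv_cancel₀ (hE i)
  have hd : ∀ i j k : Fin N, coordDeriv k (fun z => Matrix.diagonal (E z) i j) y
      = if i = j then coordDeriv k (fun z => E z i) y else 0 := by
    intro i j k
    split_ifs with h
    · subst h; simp
    · simp [Matrix.diagonal_apply_ne _ h]
  unfold christoffel
  rw [hinv, Finset.sum_eq_single a]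
  · simp only [Matrix.diagonal_apply_eq, hd]
  · intro d _ hda
    rw [Matrix.diagonal_apply_ne _ (Ne.symm hda), zero_mul]
  · simp

end CoordDeriv

namespace StaticSpacetime

variable {m : ℕ} (M : StaticSpacetime m)

/-- The diagonal entries of the metric. -/
noncomputable def metricDiag (y : Fin (m + 4) → ℝ) : Fin (m + 4) → ℝ :=
  Fin.cons (-M.f (y 1)) (Fin.cons (M.g (y 1)) (Fin.cons ((y 1) ^ 2)
      (fun i : Fin (m + 1) => (y 1) ^ 2 * (M.sym.s (y 2) ^ 2 *
        ∏ j ∈ Finset.univ.filter (fun j : Fin (m + 1) => j < i),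
          Real.sin (y j.succ.succ.succ) ^ 2))))

lemma metric_apply (y : Fin (m + 4) → ℝ) (i j : Fin (m + 4)) :
    M.metric y i j = if i = j then M.metricDiag y i else 0 := by
  change Matrix.diagonal (M.metricDiag y) i j = _
  rw [Matrix.diagonal_apply]

lemma metricDiag_zero (y : Fin (m + 4) → ℝ) : M.metricDiag y 0 = -M.f (y 1) := rfl
lemma metricDiag_one (y : Fin (m + 4) → ℝ) : M.metricDiag y 1 = M.g (y 1) := rfl
lemma metricDiag_two (y : Fin (m + 4) → ℝ) : M.metricDiag y 2 = y 1 ^ 2 := rfl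
lemma metricDiag_succ (y : Fin (m + 4) → ℝ) (i : Fin (m + 1)) :
    M.metricDiag y i.succ.succ.succ = (y 1) ^ 2 * (M.sym.s (y 2) ^ 2 *
        ∏ j ∈ Finset.univ.filter (fun j : Fin (m + 1) => j < i),
          Real.sin (y j.succ.succ.succ) ^ 2) := rfl

variable {M} {y : Fin (m + 4) → ℝ}

lemma angular_pos (hy : y ∈ M.coordDomain) (i : Fin (m + 1)) :
    0 < M.sym.s (y 2) ^ 2 * ∏ j ∈ Finset.univ.filter (fun j : Fin (m + 1) => j < i),
          Real.sin (y j.succ.succ.succ) ^ 2 := by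
  refine mul_pos (sq_pos_of_ne_zero (M.sym.s_ne_zero hy.2.1)) (Finset.prod_pos fun j hj => ?_)
  have hj : j < i := by simpa using hj
  have hj' : j.val < m := by have := i.is_lt; omega
  exact pow_pos (Real.sin_pos_of_mem_Ioo (hy.2.2 ⟨j, hj'⟩)) 2

lemma metricDiag_ne_zero (hy : y ∈ M.coordDomain) (i : Fin (m + 4)) : M.metricDiag y i ≠ 0 := by
  have h1 := M.radii_pos _ hy.1
  refine Fin.cases ?_ (Fin.cases ?_ (Fin.cases ?_ fun i => ?_)) i
  · exact neg_ne_zero.2 (M.f_pos _ hy.1).ne'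
  · exact (M.g_pos _ hy.1).ne'
  · exact (pow_pos h1 2).ne'
  · exact (mul_pos (pow_pos h1 2) (angular_pos hy i)).ne'

lemma christoffel_metric (hy : y ∈ M.coordDomain) (a b c : Fin (m + 4)) :
    christoffel M.metric y a b c = 1 / 2 * ((M.metricDiag y a)⁻¹ *
      ((if a = c then coordDeriv b (fun z => M.metricDiag z a) y else 0)
        + (if a = b then coordDeriv c (fun z => M.metricDiag z a) y else 0)
        - (if b = c then coordDeriv a (fun z => M.metricDiag z b) y else 0))) :=
  christoffel_diagonal M.metricDiag y (metricDiag_ne_zero hy) a b c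

lemma coordDeriv_metricDiag_zero (i : Fin (m + 4)) :
    coordDeriv i (fun z => M.metricDiag z 0) y = if i = 1 then -deriv M.f (y 1) else 0 := by
  simp only [metricDiag_zero]
  rw [coordDeriv_comp i 1 (fun x => -M.f x)]
  simp

lemma coordDeriv_metricDiag_one (i : Fin (m + 4)) :
    coordDeriv i (fun z => M.metricDiag z 1) y = if i = 1 then deriv M.g (y 1) else 0 :=
  coordDeriv_comp i 1 M.g y

lemma coordDeriv_metricDiag_two (i : Fin (m + 4)) :
    coordDeriv i (fun z => M.metricDiag z 2) y = if i = 1 then 2 * y 1 else 0 := by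
  simp only [metricDiag_two]
  rw [coordDeriv_comp i 1 (fun x => x ^ 2)]
  simp

lemma coordDeriv_zero_metricDiag (i : Fin (m + 4)) :
    coordDeriv 0 (fun z => M.metricDiag z i) y = 0 := by
  have h : ∀ x, M.metricDiag (Function.update y 0 x) i = M.metricDiag y i := by
    intro x
    unfold metricDiag
    congr 1
  simp [coordDeriv, h]

lemma coordDeriv_one_metricDiag_succ (i : Fin (m + 1)) :
    coordDeriv 1 (fun z => M.metricDiag z i.succ.succ.succ) y
      = 2 * y 1 * (M.sym.s (y 2) ^ 2 *
        ∏ j ∈ Finset.univ.filter (fun j : Fin (m + 1) => j < i),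
          Real.sin (y j.succ.succ.succ) ^ 2) := by
  have h : ∀ x, M.metricDiag (Function.update y 1 x) i.succ.succ.succ
      = x ^ 2 * (M.sym.s (y 2) ^ 2 *
        ∏ j ∈ Finset.univ.filter (fun j : Fin (m + 1) => j < i),
          Real.sin (y j.succ.succ.succ) ^ 2) := by
    intro x
    rfl
  simp only [coordDeriv, h]
  simp

/-- The contracted Christoffel symbols `Γ^a_{a1}`. -/
lemma sum_christoffel_one (hy : y ∈ M.coordDomain) :
    ∑ a, christoffel M.metric y a a 1
      = deriv M.f (y 1) / (2 * M.f (y 1)) + deriv M.g (y 1) / (2 * M.g (y 1))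
        + (m + 2) / y 1 := by
  have hr := (M.radii_pos _ hy.1).ne'
  have hf := (M.f_pos _ hy.1).ne'
  have hg := (M.g_pos _ hy.1).ne'
  have h : ∀ a, christoffel M.metric y a a 1
      = 1 / 2 * ((M.metricDiag y a)⁻¹ * coordDeriv 1 (fun z => M.metricDiag z a) y) := by
    intro a
    rw [christoffel_metric hy]
    by_cases ha : a = 1
    · subst ha; simp
    · simp [ha]
  simp only [h]
  rw [Fin.sum_univ_succ, Fin.sum_univ_succ, Fin.sum_univ_succ]
  have h3 : ∀ i : Fin (m + 1), 1 / 2 * ((M.metricDiag y i.succ.succ.succ)⁻¹ *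
      coordDeriv 1 (fun z => M.metricDiag z i.succ.succ.succ) y) = 1 / y 1 := by
    intro i
    rw [coordDeriv_one_metricDiag_succ, metricDiag_succ]
    have := (angular_pos hy i).ne'
    generalize M.sym.s (y 2) ^ 2 * _ = A at this ⊢
    field_simp
  simp only [h3, Fin.succ_zero_eq_one, Fin.succ_one_eq_two, coordDeriv_metricDiag_zero,
    coordDeriv_metricDiag_one, coordDeriv_metricDiag_two, if_true, Finset.sum_const, Finset.card_univ, Fintype.card_fin, nsmul_eq_mul]
  simp only [metricDiag_zero, metricDiag_one, metricDiag_two]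
  push_cast
  field_simp
  ring

lemma sum_christoffel_zero (hy : y ∈ M.coordDomain) :
    ∑ a, christoffel M.metric y a a 0 = 0 := by
  refine Finset.sum_eq_zero fun a _ => ?_
  rw [christoffel_metric hy]
  by_cases ha : a = 0
  · subst ha; simp [coordDeriv_zero_metricDiag]
  · simp [ha, coordDeriv_zero_metricDiag]

/-- The geodesic acceleration of a curve in the surface swept out by `t`, `r` and `χ`. -/
lemma sum_christoffel_mul_mul (hy : y ∈ M.coordDomain) (t' r' χ' : ℝ) (i : Fin (m + 4)) :
    -∑ j, ∑ k, christoffel M.metric y i j k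
        * (Fin.cons t' (Fin.cons r' (Fin.cons χ' (fun _ => 0))) : Fin (m + 4) → ℝ) j
        * (Fin.cons t' (Fin.cons r' (Fin.cons χ' (fun _ => 0))) : Fin (m + 4) → ℝ) k
      = (Fin.cons (-(deriv M.f (y 1) / M.f (y 1)) * r' * t') (Fin.cons
          (-(deriv M.f (y 1) / (2 * M.g (y 1))) * t' ^ 2
            - deriv M.g (y 1) / (2 * M.g (y 1)) * r' ^ 2 + y 1 / M.g (y 1) * χ' ^ 2)
          (Fin.cons (-(2 / y 1) * r' * χ') (fun _ => 0))) : Fin (m + 4) → ℝ) i := by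
  have hr := (M.radii_pos _ hy.1).ne'
  have hf := (M.f_pos _ hy.1).ne'
  have hg := (M.g_pos _ hy.1).ne'
  have e1 : (Fin.succ 0 : Fin (m + 4)) = 1 := rfl
  have e2 : (Fin.succ (Fin.succ 0) : Fin (m + 4)) = 2 := rfl
  have n01 : (0 : Fin (m + 4)) ≠ 1 := (Fin.succ_ne_zero 0).symm
  have n01' : (0 : Fin (m + 3)) ≠ Fin.succ 0 := (Fin.succ_ne_zero 0).symm
  have n02 : (0 : Fin (m + 4)) ≠ 2 := (Fin.succ_ne_zero (Fin.succ 0)).symm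
  have n12 : (1 : Fin (m + 4)) ≠ 2 := fun h => n01' (Fin.succ_injective _ h)
  simp only [Fin.sum_univ_succ, Fin.cons_succ, Fin.cons_zero, mul_zero, zero_mul,
    Finset.sum_const_zero, add_zero, e2, e1, christoffel_metric hy]
  refine Fin.cases ?_ (Fin.cases ?_ (Fin.cases ?_ fun i => ?_)) i
  · simp only [Fin.cons_zero, coordDeriv_metricDiag_zero, coordDeriv_metricDiag_one,
      coordDeriv_metricDiag_two, n01, n02, n12, n01.symm, n02.symm, n12.symm, if_true, if_false]
    simp only [metricDiag_zero]
    field_simp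
    ring
  · simp only [Fin.cons_zero, Fin.cons_succ]
    simp only [e1, coordDeriv_metricDiag_zero,
      coordDeriv_metricDiag_one,
      coordDeriv_metricDiag_two, n01, n02, n12, n01.symm, n02.symm, n12.symm, if_true, if_false]
    simp only [metricDiag_one]
    field_simp
    ring
  · simp only [Fin.cons_zero, Fin.cons_succ]
    simp only [e2, coordDeriv_metricDiag_zero,
      coordDeriv_metricDiag_one,
      coordDeriv_metricDiag_two, n01, n02, n12, n01.symm, n02.symm, n12.symm, if_true, if_false]
    simp only [metricDiag_two]
    field_simp
    ring
  -- The `t`, `r` and `χ` entries of the metric do not depend on the angles, so no angular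
  -- acceleration arises.
  · have a0 : i.succ.succ.succ ≠ 0 := Fin.succ_ne_zero _
    have a1 : i.succ.succ.succ ≠ 1 := fun h =>
      Fin.succ_ne_zero _ (Fin.succ_injective _ h)
    have a2 : i.succ.succ.succ ≠ 2 := fun h =>
      Fin.succ_ne_zero _ (Fin.succ_injective _ (Fin.succ_injective _ h))
    simp only [coordDeriv_metricDiag_zero, coordDeriv_metricDiag_one,
      coordDeriv_metricDiag_two, a0, a1, a2, if_false, n01, n02, n12, n01.symm, n02.symm, n12.symm,
      Fin.cons_succ]
    simp

lemma sum_metric (t' r' χ' : ℝ) (w : Fin (m + 1) → ℝ) :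
    ∑ i, ∑ j, M.metric y i j
        * (Fin.cons t' (Fin.cons r' (Fin.cons χ' w)) : Fin (m + 4) → ℝ) i
        * (Fin.cons t' (Fin.cons r' (Fin.cons χ' w)) : Fin (m + 4) → ℝ) j
      = -M.f (y 1) * t' ^ 2 + M.g (y 1) * r' ^ 2 + y 1 ^ 2 * (χ' ^ 2 + M.sym.s (y 2) ^ 2 *
        ∑ i, (∏ j ∈ Finset.univ.filter (fun j : Fin (m + 1) => j < i),
          Real.sin (y j.succ.succ.succ) ^ 2) * w i ^ 2) := by
  simp only [metric_apply, ite_mul, zero_mul, Finset.sum_ite_eq, Finset.mem_univ, if_true]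
  rw [Fin.sum_univ_succ, Fin.sum_univ_succ, Fin.sum_univ_succ]
  simp only [Fin.succ_zero_eq_one, Fin.succ_one_eq_two, metricDiag_zero, metricDiag_one,
    metricDiag_two, metricDiag_succ, Fin.cons_zero, Fin.cons_succ]
  have e1 : (Fin.cons t' (Fin.cons r' (Fin.cons χ' w)) : Fin (m + 4) → ℝ) 1 = r' := rfl
  have e2 : (Fin.cons t' (Fin.cons r' (Fin.cons χ' w)) : Fin (m + 4) → ℝ) 2 = χ' := rfl
  rw [e1, e2, mul_add, Finset.mul_sum, Finset.mul_sum]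
  have : ∀ i : Fin (m + 1), y 1 ^ 2 * (M.sym.s (y 2) ^ 2 *
      ∏ j ∈ Finset.univ.filter (fun j : Fin (m + 1) => j < i),
          Real.sin (y j.succ.succ.succ) ^ 2) * w i * w i
      = y 1 ^ 2 * (M.sym.s (y 2) ^ 2 *
      ((∏ j ∈ Finset.univ.filter (fun j : Fin (m + 1) => j < i),
          Real.sin (y j.succ.succ.succ) ^ 2) * w i ^ 2)) := fun i => by ring
  simp only [this]
  ring

end StaticSpacetime

/-! ### Null geodesics in polar coordinates and in the ambient model. -/

/-- With all angles at `π / 2`, the interior of their range, the direction is the last frame vector;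
this is why frames are built with the direction of motion last. -/
lemma sphereVector_pi_div_two {m : ℕ} (j : Fin (m + 2)) :
    sphereVector (fun _ : Fin (m + 1) => Real.pi / 2) j = if j = Fin.last (m + 1) then 1 else 0 := by
  unfold sphereVector
  by_cases h : j = Fin.last (m + 1)
  · simp [h]
  · have : j.val < m + 1 := by
      have := Fin.val_lt_last h
      simpa using this
    simp [h, this]

lemma hasDerivAt_cons {N : ℕ} {u : ℝ → ℝ} {w : ℝ → Fin N → ℝ} {u' τ : ℝ} {w' : Fin N → ℝ}
    (hu : HasDerivAt u u' τ) (hw : HasDerivAt w w' τ) :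
    HasDerivAt (fun τ => (Fin.cons (u τ) (w τ) : Fin (N + 1) → ℝ)) (Fin.cons u' w') τ :=
  hasDerivAt_pi.2 fun i => Fin.cases hu (fun j => hasDerivAt_pi.1 hw j) i

namespace StaticSpacetime

variable {m : ℕ} {M : StaticSpacetime m}

/-- A curve above a geodesic of the model space is a null geodesic if `t`, `r` and the distance
`φ` along that geodesic satisfy the geodesic equations. -/
lemma isNullGeodesic_of {X U : Fin (m + 3) → ℝ} (hX : X ∈ M.sym.space m)
    (hU : U ∈ M.sym.tangent X) (h1 : M.sym.form U U = 1) {t r φ t' r' φ' : ℝ → ℝ} {a b : ℝ}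
    (hr : ∀ τ ∈ Set.Ioo a b, r τ ∈ M.radii)
    (dt : ∀ τ ∈ Set.Ioo a b, HasDerivAt t (t' τ) τ)
    (dr : ∀ τ ∈ Set.Ioo a b, HasDerivAt r (r' τ) τ)
    (dφ : ∀ τ ∈ Set.Ioo a b, HasDerivAt φ (φ' τ) τ)
    (dt' : ∀ τ ∈ Set.Ioo a b,
      HasDerivAt t' (-(deriv M.f (r τ) / M.f (r τ)) * r' τ * t' τ) τ)
    (dr' : ∀ τ ∈ Set.Ioo a b,
      HasDerivAt r' (-(deriv M.f (r τ) / (2 * M.g (r τ))) * t' τ ^ 2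
        - deriv M.g (r τ) / (2 * M.g (r τ)) * r' τ ^ 2 + r τ / M.g (r τ) * φ' τ ^ 2) τ)
    (dφ' : ∀ τ ∈ Set.Ioo a b, HasDerivAt φ' (-(2 / r τ) * r' τ * φ' τ) τ)
    (hne : ∀ τ ∈ Set.Ioo a b, φ' τ ≠ 0)
    (null : ∀ τ ∈ Set.Ioo a b,
      -M.f (r τ) * t' τ ^ 2 + M.g (r τ) * r' τ ^ 2 + r τ ^ 2 * φ' τ ^ 2 = 0) :
    M.IsNullGeodesic (fun τ => (t τ, r τ, M.sym.c (φ τ) • X + M.sym.s (φ τ) • U)) a b := by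
  intro τ₀ hτ₀
  -- Polar coordinates degenerate at `χ = 0`. Centring them one unit behind the point `φ τ₀` makes
  -- `χ = 1` at `τ₀`, which is admissible in all three geometries.
  obtain ⟨e, he, hlast⟩ := SpatialSymmetry.exists_frame
    (SpatialSymmetry.add_smul_mem_space hX hU h1 (φ τ₀ - 1))
    (SpatialSymmetry.add_smul_mem_tangent hX hU h1 (φ τ₀ - 1))
    (SpatialSymmetry.form_velocity_self hX hU h1 (φ τ₀ - 1))
  refine ⟨_, e, fun τ => Fin.cons (t τ) (Fin.cons (r τ) (Fin.cons (φ τ - φ τ₀ + 1)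
    (fun _ => Real.pi / 2))), fun τ => Fin.cons (t' τ) (Fin.cons (r' τ) (Fin.cons (φ' τ)
    (fun _ => 0))), he, ?_⟩
  have hχ : ∀ᶠ τ in nhds τ₀, φ τ - φ τ₀ + 1 ∈ M.sym.chiRange := by
    have hcont : ContinuousAt (fun τ => φ τ - φ τ₀ + 1) τ₀ :=
      ((dφ τ₀ hτ₀).continuousAt.sub continuousAt_const).add continuousAt_const
    apply hcont.eventually_mem
    apply M.sym.isOpen_chiRange.mem_nhds
    simpa using M.sym.one_mem_chiRange
  filter_upwards [isOpen_Ioo.mem_nhds hτ₀, hχ] with τ hτ hχτ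
  have hdom : (Fin.cons (t τ) (Fin.cons (r τ) (Fin.cons (φ τ - φ τ₀ + 1)
      (fun _ => Real.pi / 2))) : Fin (m + 4) → ℝ) ∈ M.coordDomain := by
    refine ⟨hr τ hτ, hχτ, fun i => ?_⟩
    simp only [Fin.cons_succ]
    exact ⟨by positivity, by linarith [Real.pi_pos]⟩
  refine ⟨hdom, ?_, ?_, ?_, ?_, ?_⟩
  · have hφ : φ τ = (φ τ₀ - 1) + (φ τ - φ τ₀ + 1) := by ring
    unfold polar
    refine Prod.ext rfl (Prod.ext rfl ?_)
    change M.sym.c (φ τ) • X + M.sym.s (φ τ) • U = _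
    conv_lhs => rw [hφ, SpatialSymmetry.add_smul_add]
    simp only [Fin.cons_succ, sphereVector_pi_div_two, ite_smul, one_smul, zero_smul,
      Finset.sum_ite_eq', Finset.mem_univ, if_true, hlast]
    rfl
  · exact hasDerivAt_cons (dt τ hτ) (hasDerivAt_cons (dr τ hτ)
      (hasDerivAt_cons (((dφ τ hτ).sub_const _).add_const _) (hasDerivAt_const _ _)))
  · simp only [sum_christoffel_mul_mul hdom]
    exact hasDerivAt_cons (dt' τ hτ) (hasDerivAt_cons (dr' τ hτ)
      (hasDerivAt_cons (dφ' τ hτ) (hasDerivAt_const _ _)))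
  · intro h
    exact hne τ hτ (congrFun h 2)
  · rw [sum_metric]
    simpa using null τ hτ

end StaticSpacetime

lemma sphereVector_zero {m : ℕ} (θ : Fin (m + 1) → ℝ) :
    sphereVector θ 0 = Real.cos (θ 0) := by
  simp [sphereVector]

lemma sphereVector_succ {m : ℕ} (θ : Fin (m + 2) → ℝ) (j : Fin (m + 2)) :
    sphereVector θ j.succ = Real.sin (θ 0) * sphereVector (Fin.tail θ) j := by
  unfold sphereVector
  rw [Finset.prod_filter, Fin.prod_univ_succ, Finset.prod_filter]
  simp [Fin.tail, mul_assoc]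

/-- The parametrization of the unit sphere by angles, along a differentiable curve. -/
lemma exists_hasDerivAt_sphereVector {m : ℕ} {θ : ℝ → Fin (m + 1) → ℝ} {θ' : Fin (m + 1) → ℝ}
    {τ : ℝ} (h : HasDerivAt θ θ' τ) :
    ∃ w : Fin (m + 2) → ℝ, (∀ j, HasDerivAt (fun τ => sphereVector (θ τ) j) (w j) τ) ∧
      ∑ j, sphereVector (θ τ) j ^ 2 = 1 ∧ ∑ j, sphereVector (θ τ) j * w j = 0 ∧
      ∑ j, w j ^ 2 = ∑ i, (∏ j ∈ Finset.univ.filter (fun j : Fin (m + 1) => j < i),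
          Real.sin (θ τ j) ^ 2) * θ' i ^ 2 := by
  induction m with
  | zero =>
    have h0 := hasDerivAt_pi.1 h 0
    have e0 : ∀ τ, sphereVector (θ τ) 0 = Real.cos (θ τ 0) := fun τ => sphereVector_zero _
    have e1 : ∀ τ, sphereVector (θ τ) 1 = Real.sin (θ τ 0) := by
      intro τ
      simp [sphereVector]
    refine ⟨![-Real.sin (θ τ 0) * θ' 0, Real.cos (θ τ 0) * θ' 0], ?_, ?_, ?_, ?_⟩
    · refine Fin.forall_fin_two.2 ⟨?_, ?_⟩
      · exact h0.cos.congr_of_eventuallyEq (Filter.Eventually.of_forall e0)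
      · exact h0.sin.congr_of_eventuallyEq (Filter.Eventually.of_forall e1)
    · refine (Fin.sum_univ_two _).trans ?_
      rw [e0, e1]
      exact Real.cos_sq_add_sin_sq _
    · refine (Fin.sum_univ_two _).trans ?_
      rw [e0, e1]
      simp only [Matrix.cons_val_zero, Matrix.cons_val_one]
      ring
    · refine (Fin.sum_univ_two _).trans ?_
      simp
      linear_combination θ' 0 ^ 2 * Real.cos_sq_add_sin_sq (θ τ 0)
  | succ m ih =>
    have h0 := hasDerivAt_pi.1 h 0
    have ht : HasDerivAt (fun τ => Fin.tail (θ τ)) (Fin.tail θ') τ :=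
      hasDerivAt_pi.2 fun i => hasDerivAt_pi.1 h i.succ
    obtain ⟨w, hw, hs, ho, hn⟩ := ih ht
    -- The product rule for `(cos θ₀, sin θ₀ P)` with `P` on the smaller sphere. Cross terms vanish
    -- because `P` is orthogonal to its derivative.
    refine ⟨Fin.cons (-Real.sin (θ τ 0) * θ' 0) (fun j => Real.cos (θ τ 0) * θ' 0 *
      sphereVector (Fin.tail (θ τ)) j + Real.sin (θ τ 0) * w j), ?_, ?_, ?_, ?_⟩
    · intro j
      refine Fin.cases ?_ (fun j => ?_) j
      · simp only [sphereVector_zero]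
        exact h0.cos
      · simp only [sphereVector_succ]
        exact h0.sin.mul (hw j)
    · rw [Fin.sum_univ_succ]
      simp only [sphereVector_zero, sphereVector_succ, mul_pow, ← Finset.mul_sum, hs]
      linear_combination Real.cos_sq_add_sin_sq (θ τ 0)
    · rw [Fin.sum_univ_succ]
      simp only [sphereVector_zero, sphereVector_succ, Fin.cons_zero, Fin.cons_succ]
      have : ∀ j, Real.sin (θ τ 0) * sphereVector (Fin.tail (θ τ)) j * (Real.cos (θ τ 0) * θ' 0 *
          sphereVector (Fin.tail (θ τ)) j + Real.sin (θ τ 0) * w j)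
          = Real.sin (θ τ 0) * Real.cos (θ τ 0) * θ' 0 * sphereVector (Fin.tail (θ τ)) j ^ 2
            + Real.sin (θ τ 0) ^ 2 * (sphereVector (Fin.tail (θ τ)) j * w j) := fun j => by ring
      simp only [this, Finset.sum_add_distrib, ← Finset.mul_sum, hs, ho]
      ring
    · rw [Fin.sum_univ_succ]
      conv_rhs => rw [Fin.sum_univ_succ]
      simp only [Fin.cons_zero, Fin.cons_succ]
      have e : ∀ j, (Real.cos (θ τ 0) * θ' 0 *
          sphereVector (Fin.tail (θ τ)) j + Real.sin (θ τ 0) * w j) ^ 2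
          = (Real.cos (θ τ 0) * θ' 0) ^ 2 * sphereVector (Fin.tail (θ τ)) j ^ 2
            + 2 * Real.cos (θ τ 0) * θ' 0 * Real.sin (θ τ 0)
              * (sphereVector (Fin.tail (θ τ)) j * w j)
            + Real.sin (θ τ 0) ^ 2 * w j ^ 2 := fun j => by ring
      have e' : ∀ i : Fin (m + 1), (∏ j ∈ Finset.univ.filter (fun j : Fin (m + 2) => j < i.succ),
          Real.sin (θ τ j) ^ 2) * θ' i.succ ^ 2
          = Real.sin (θ τ 0) ^ 2 * ((∏ j ∈ Finset.univ.filter (fun j : Fin (m + 1) => j < i),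
            Real.sin (Fin.tail (θ τ) j) ^ 2) * Fin.tail θ' i ^ 2) := by
        intro i
        rw [Finset.prod_filter, Fin.prod_univ_succ, Finset.prod_filter]
        simp [Fin.tail, mul_assoc]
      simp only [e, e', Finset.sum_add_distrib, ← Finset.mul_sum, hs, ho, hn]
      simp
      linear_combination θ' 0 ^ 2 * Real.cos_sq_add_sin_sq (θ τ 0)

namespace StaticSpacetime

variable {m : ℕ} {M : StaticSpacetime m}

/-- Position and velocity of a null geodesic. -/
lemma IsNullGeodesic.exists_velocity {γ : ℝ → STPoint m} {a b τ : ℝ}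
    (hγ : M.IsNullGeodesic γ a b) (hτ : τ ∈ Set.Ioo a b) :
    (γ τ).2.1 ∈ M.radii ∧ (γ τ).2.2 ∈ M.sym.space m ∧ ∃ k : STPoint m, HasDerivAt γ k τ ∧
      k.2.2 ∈ M.sym.tangent (γ τ).2.2 ∧ k ≠ 0 ∧ M.normSq (γ τ).2.1 k = 0 := by
  obtain ⟨o, e, y, v, he, hev⟩ := hγ τ hτ
  have hγy : γ =ᶠ[nhds τ] fun τ => M.polar o e (y τ) := hev.mono fun _ h => h.2.1
  obtain ⟨hy, hpt, hdy, -, hv0, hnull⟩ := hev.self_of_nhds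
  have dcomp := hasDerivAt_pi.1 hdy
  obtain ⟨w, hw, hs, ho, hn⟩ := exists_hasDerivAt_sphereVector
    (hasDerivAt_pi.2 fun i : Fin (m + 1) => dcomp i.succ.succ.succ)
  set P : Fin (m + 2) → ℝ := sphereVector (fun i : Fin (m + 1) => y τ i.succ.succ.succ) with hP
  -- `W` is the unit direction from `o` to the moving point and `z` its derivative. With `V` the
  -- radial unit vector, the spatial velocity is the orthogonal sum `χ' V + s z`, which gives the
  -- polar line element.
  set W : Fin (m + 3) → ℝ := ∑ j, P j • e j with hWdef
  set z : Fin (m + 3) → ℝ := ∑ j, w j • e j with hzdef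
  have bil : ∀ α β : Fin (m + 2) → ℝ, M.sym.form (∑ j, α j • e j) (∑ j, β j • e j)
      = ∑ j, α j * β j := by
    intro α β
    rw [← SpatialSymmetry.formBilin_apply]
    simp [map_sum, LinearMap.sum_apply, SpatialSymmetry.formBilin_apply, he.orthonormal,
      mul_comm]
  have tan : ∀ α : Fin (m + 2) → ℝ, ∑ j, α j • e j ∈ M.sym.tangent o := by
    intro α
    rw [SpatialSymmetry.mem_tangent_iff]
    exact Submodule.sum_mem _ fun j _ => Submodule.smul_mem _ _
      ((M.sym.mem_tangent_iff).1 (he.tangent j))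
  have hWW : M.sym.form W W = 1 := by
    rw [hWdef, bil, ← hs]
    exact Finset.sum_congr rfl fun j _ => (pow_two _).symm
  have hWz : M.sym.form W z = 0 := by rw [hWdef, hzdef, bil, ← ho]
  have hzz : M.sym.form z z = ∑ i, (∏ j ∈ Finset.univ.filter (fun j : Fin (m + 1) => j < i),
          Real.sin (y τ j.succ.succ.succ) ^ 2) * v τ i.succ.succ.succ ^ 2 := by
    rw [hzdef, bil, ← hn]
    exact Finset.sum_congr rfl fun j _ => (pow_two _).symm
  have hγτ : γ τ = (y τ 0, y τ 1, M.sym.c (y τ 2) • o + M.sym.s (y τ 2) • W) := hpt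
  set Y : Fin (m + 3) → ℝ := M.sym.c (y τ 2) • o + M.sym.s (y τ 2) • W with hY
  set V : Fin (m + 3) → ℝ := (-M.sym.curv * M.sym.s (y τ 2)) • o + M.sym.c (y τ 2) • W with hV
  have hYmem : Y ∈ M.sym.space m := SpatialSymmetry.add_smul_mem_space he.mem (tan P) hWW _
  have hVtan : V ∈ M.sym.tangent Y := SpatialSymmetry.add_smul_mem_tangent he.mem (tan P) hWW _
  have hztan : z ∈ M.sym.tangent Y := SpatialSymmetry.mem_tangent_add_smul (tan w) hWz _ _
  have hVV : M.sym.form V V = 1 := SpatialSymmetry.form_velocity_self he.mem (tan P) hWW _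
  have hVz : M.sym.form V z = 0 := SpatialSymmetry.form_velocity_tangent (tan w) hWz _
  have hdW : HasDerivAt (fun τ => ∑ j, sphereVector
      (fun i : Fin (m + 1) => y τ i.succ.succ.succ) j • e j) z τ :=
    HasDerivAt.fun_sum fun j _ => (hw j).smul_const (e j)
  have hdX : HasDerivAt (fun τ => M.sym.c (y τ 2) • o + M.sym.s (y τ 2) • ∑ j, sphereVector
      (fun i : Fin (m + 1) => y τ i.succ.succ.succ) j • e j)
      (v τ 2 • V + M.sym.s (y τ 2) • z) τ := by
    have hc : HasDerivAt (fun τ => M.sym.c (y τ 2)) (-M.sym.curv * M.sym.s (y τ 2) * v τ 2) τ :=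
      (M.sym.hasDerivAt_c (y τ 2)).comp τ (dcomp 2)
    have hs : HasDerivAt (fun τ => M.sym.s (y τ 2)) (M.sym.c (y τ 2) * v τ 2) τ :=
      (M.sym.hasDerivAt_s (y τ 2)).comp τ (dcomp 2)
    refine ((hc.smul_const o).add (hs.smul hdW)).congr_deriv ?_
    ext i
    simp only [hV, Pi.add_apply, Pi.smul_apply, smul_eq_mul, hWdef, hP]
    ring
  set K : Fin (m + 3) → ℝ := v τ 2 • V + M.sym.s (y τ 2) • z with hK
  have hKK : M.sym.form K K = v τ 2 ^ 2 + M.sym.s (y τ 2) ^ 2 * M.sym.form z z := by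
    simp only [hK, SpatialSymmetry.form_add_left, SpatialSymmetry.form_add_right,
      SpatialSymmetry.form_smul_left, SpatialSymmetry.form_smul_right, hVV, hVz,
      M.sym.form_comm z V]
    ring
  have hvcons : v τ = Fin.cons (v τ 0) (Fin.cons (v τ 1) (Fin.cons (v τ 2)
      (fun i : Fin (m + 1) => v τ i.succ.succ.succ))) := by
    ext i
    refine Fin.cases rfl (Fin.cases rfl (Fin.cases rfl fun i => rfl)) i
  rw [hvcons, sum_metric, ← hzz, ← hKK] at hnull
  rw [hγτ]
  refine ⟨hy.1, hYmem, (v τ 0, v τ 1, K), ?_, ?_, ?_, hnull⟩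
  · exact HasDerivAt.congr_of_eventuallyEq ((dcomp 0).prodMk ((dcomp 1).prodMk hdX)) hγy
  · rw [SpatialSymmetry.mem_tangent_iff] at *
    exact Submodule.add_mem _ (Submodule.smul_mem _ _ hVtan) (Submodule.smul_mem _ _ hztan)
  -- If the ambient velocity vanishes, so do all the nonnegative terms of its square; their
  -- coefficients are positive inside the coordinate domain, so the coordinate velocity vanishes
  -- too.
  · intro h0
    simp only [Prod.mk_eq_zero] at h0
    obtain ⟨v0, v1, K0⟩ := h0
    have hzero : M.sym.form K K = 0 := by
      rw [K0]; simp [SpatialSymmetry.form]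
    rw [hKK, hzz, Finset.mul_sum] at hzero
    have hterm : ∀ i : Fin (m + 1), 0 ≤ M.sym.s (y τ 2) ^ 2 *
        ((∏ j ∈ Finset.univ.filter (fun j : Fin (m + 1) => j < i),
          Real.sin (y τ j.succ.succ.succ) ^ 2) * v τ i.succ.succ.succ ^ 2) := by
      intro i
      positivity
    have hsum := Finset.sum_nonneg fun i (_ : i ∈ Finset.univ) => hterm i
    have v2 : v τ 2 = 0 := pow_eq_zero_iff two_ne_zero |>.1 (by nlinarith [sq_nonneg (v τ 2)])
    have hs0 := (Finset.sum_eq_zero_iff_of_nonneg fun i (_ : i ∈ Finset.univ) => hterm i).1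
      (by nlinarith [sq_nonneg (v τ 2)])
    apply hv0
    ext i
    refine Fin.cases v0 (Fin.cases v1 (Fin.cases v2 fun i => ?_)) i
    have := hs0 i (Finset.mem_univ _)
    rw [← mul_assoc] at this
    exact pow_eq_zero_iff two_ne_zero |>.1
      ((mul_eq_zero.1 this).resolve_left (angular_pos hy i).ne')

end StaticSpacetime

/-! ### The conservation laws as radial equations. -/

namespace StaticSpacetime

variable {m : ℕ} {M : StaticSpacetime m}

/-- The logarithmic derivative of `√(f g) r^(m+2)`. -/
noncomputable def expansion (M : StaticSpacetime m) (r : ℝ) : ℝ :=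
  deriv M.f r / (2 * M.f r) + deriv M.g r / (2 * M.g r) + (m + 2) / r

lemma exists_mem_coordDomain {r : ℝ} (hr : r ∈ M.radii) : ∃ y ∈ M.coordDomain, y 1 = r := by
  refine ⟨Fin.cons 0 (Fin.cons r (Fin.cons 1 (fun _ => Real.pi / 2))),
    ⟨hr, M.sym.one_mem_chiRange, fun i => ?_⟩, rfl⟩
  simp only [Fin.cons_succ]
  exact ⟨by positivity, by linarith [Real.pi_pos]⟩

/-- `Γ^a_{ab}` is the logarithmic derivative of the volume density. It vanishes for `b = t`, and
without a component along the model space only `b = r` is left. -/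
lemma sum_sum_christoffel {y : Fin (m + 4) → ℝ} (hy : y ∈ M.coordDomain) (W : Fin (m + 4) → ℝ)
    (hW : ∀ i : Fin (m + 2), W i.succ.succ = 0) :
    ∑ a, ∑ b, christoffel M.metric y a a b * W b = M.expansion (y 1) * W 1 := by
  rw [Finset.sum_comm]
  simp only [← Finset.sum_mul]
  rw [Finset.sum_eq_single 1, sum_christoffel_one hy]
  · rfl
  · intro b _ hb
    refine Fin.cases ?_ (Fin.cases ?_ fun i => ?_) b hb
    · intro _
      rw [sum_christoffel_zero hy, zero_mul]
    · exact fun h => absurd rfl h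
    · intro _
      rw [hW, mul_zero]
  · simp

lemma divVector_radialField {y : Fin (m + 4) → ℝ} (hy : y ∈ M.coordDomain) (n ut ur : ℝ → ℝ) :
    divVector M.metric (fun z a => n (z 1) * radialField ut ur z a) y
      = deriv (fun x => n x * ur x) (y 1) + M.expansion (y 1) * (n (y 1) * ur (y 1)) := by
  unfold divVector
  rw [Finset.sum_add_distrib, sum_sum_christoffel hy _ (fun i => by simp [radialField])]
  congr 1
  rw [Fin.sum_univ_succ, Fin.sum_univ_succ]
  have h2 : ∀ i : Fin (m + 2), coordDeriv i.succ.succ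
      (fun z : Fin (m + 4) → ℝ => n (z 1) * radialField ut ur z i.succ.succ) y = 0 := by
    intro i
    simp [radialField]
  simp only [h2, Finset.sum_const_zero, add_zero]
  have h0 := coordDeriv_comp (0 : Fin (m + 4)) 1 (fun x => n x * ut x) y
  have h1 := coordDeriv_comp (1 : Fin (m + 4)) 1 (fun x => n x * ur x) y
  rw [if_neg (by simp)] at h0
  rw [if_pos rfl] at h1
  exact (congrArg₂ (· + ·) h0 h1).trans (zero_add _)

lemma stress_apply (n h p ut ur : ℝ → ℝ) (y : Fin (m + 4) → ℝ) (a b : Fin (m + 4)) :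
    M.stress n h p ut ur y a b = n (y 1) * h (y 1) * radialField ut ur y a *
      (M.metricDiag y b * radialField ut ur y b) + p (y 1) * (if a = b then 1 else 0) := by
  simp [stress, metric_apply]

lemma sum_christoffel_stress (y : Fin (m + 4) → ℝ)
    (n h p ut ur : ℝ → ℝ) (b : Fin (m + 4)) :
    ∑ a, ∑ c, christoffel M.metric y c a b * M.stress n h p ut ur y a c
      = n (y 1) * h (y 1) * (
        -christoffel M.metric y 0 0 b * ut (y 1) * (M.f (y 1) * ut (y 1))
        + christoffel M.metric y 1 0 b * ut (y 1) * (M.g (y 1) * ur (y 1))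
        - christoffel M.metric y 0 1 b * ur (y 1) * (M.f (y 1) * ut (y 1))
        + christoffel M.metric y 1 1 b * ur (y 1) * (M.g (y 1) * ur (y 1)))
        + p (y 1) * ∑ a, christoffel M.metric y a a b := by
  simp only [stress_apply, mul_add, Finset.sum_add_distrib]
  congr 1
  · have h2 : ∀ i : Fin (m + 2), radialField ut ur y i.succ.succ = 0 := fun i => rfl
    have h1 : radialField ut ur y 1 = ur (y 1) := rfl
    have h0 : radialField ut ur y 0 = ut (y 1) := rfl
    simp only [Fin.sum_univ_succ (n := m + 3), Fin.sum_univ_succ (n := m + 2), h2, mul_zero,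
      zero_mul, Finset.sum_const_zero, add_zero, Fin.succ_zero_eq_one, h0, h1, metricDiag_zero,
      metricDiag_one]
    ring
  · simp [Finset.mul_sum, mul_comm]

/-- The metric is static, so the energy balance has no force term: it has the form of the continuity
equation, with each particle carrying `h f u^t`. -/
lemma divTensor_stress_zero {y : Fin (m + 4) → ℝ} (hy : y ∈ M.coordDomain)
    (n h p ut ur : ℝ → ℝ) :
    divTensor M.metric (M.stress n h p ut ur) y 0
      = -(deriv (fun x => n x * ur x * (h x * (M.f x * ut x))) (y 1) + M.expansion (y 1) *
        (n (y 1) * ur (y 1) * (h (y 1) * (M.f (y 1) * ut (y 1))))) := by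
  have hf := (M.f_pos _ hy.1).ne'
  have hg := (M.g_pos _ hy.1).ne'
  have n01 : (0 : Fin (m + 4)) ≠ 1 := by simp
  unfold divTensor
  rw [Finset.sum_sub_distrib, Finset.sum_add_distrib, sum_christoffel_stress y,
    sum_christoffel_zero hy, sum_sum_christoffel hy _
      (fun i => by rw [stress_apply]; simp [radialField])]
  have h2 : ∀ i : Fin (m + 2), coordDeriv i.succ.succ
      (fun z : Fin (m + 4) → ℝ => M.stress n h p ut ur z i.succ.succ 0) y = 0 := by
    intro i
    simp [stress_apply, radialField]
  have h0 := coordDeriv_comp (0 : Fin (m + 4)) 1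
    (fun x => n x * h x * ut x * (-M.f x * ut x) + p x * 1) y
  have h1 := coordDeriv_comp (1 : Fin (m + 4)) 1
    (fun x => -(n x * ur x * (h x * (M.f x * ut x)))) y
  have e0 : (fun z => M.stress n h p ut ur z 0 0)
      = fun z => n (z 1) * h (z 1) * ut (z 1) * (-M.f (z 1) * ut (z 1)) + p (z 1) * 1 := by
    funext z
    rw [stress_apply, if_pos rfl]; rfl
  have e1 : (fun z => M.stress n h p ut ur z 1 0)
      = fun z => -(n (z 1) * ur (z 1) * (h (z 1) * (M.f (z 1) * ut (z 1)))) := by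
    funext z
    have u1 : radialField ut ur z 1 = ur (z 1) := rfl
    have u0 : radialField ut ur z 0 = ut (z 1) := rfl
    rw [stress_apply, if_neg n01.symm, u1, u0, metricDiag_zero]
    ring
  rw [if_neg n01] at h0
  rw [if_pos rfl] at h1
  rw [Fin.sum_univ_succ, Fin.sum_univ_succ]
  simp only [h2, Finset.sum_const_zero, add_zero, Fin.succ_zero_eq_one]
  rw [e0, e1, h0, h1, congrFun e1 y]
  simp only [christoffel_metric hy, coordDeriv_metricDiag_zero, coordDeriv_metricDiag_one, n01,
    n01.symm, if_true, if_false, deriv.fun_neg]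
  simp only [metricDiag_zero, metricDiag_one]
  field_simp
  ring

/-- In the radial momentum balance the pressure parts of the two Christoffel terms cancel, leaving
`p'` and the force from `f'` and `g'`. -/
lemma divTensor_stress_one {y : Fin (m + 4) → ℝ} (hy : y ∈ M.coordDomain)
    (n h p ut ur : ℝ → ℝ) :
    divTensor M.metric (M.stress n h p ut ur) y 1
      = deriv (fun x => n x * ur x * (h x * (M.g x * ur x)) + p x) (y 1) + M.expansion (y 1) *
        (n (y 1) * ur (y 1) * (h (y 1) * (M.g (y 1) * ur (y 1))))
        + n (y 1) * h (y 1) * (deriv M.f (y 1) * ut (y 1) ^ 2 - deriv M.g (y 1) * ur (y 1) ^ 2)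
          / 2 := by
  have hf := (M.f_pos _ hy.1).ne'
  have hg := (M.g_pos _ hy.1).ne'
  have n01 : (0 : Fin (m + 4)) ≠ 1 := by simp
  unfold divTensor
  rw [Finset.sum_sub_distrib, Finset.sum_add_distrib, sum_christoffel_stress y,
    sum_christoffel_one hy, sum_sum_christoffel hy _
      (fun i => by
        have : i.succ.succ ≠ (1 : Fin (m + 4)) := fun h =>
          Fin.succ_ne_zero _ (Fin.succ_injective _ h)
        simp [stress_apply, radialField, this])]
  have h2 : ∀ i : Fin (m + 2), coordDeriv i.succ.succ
      (fun z : Fin (m + 4) → ℝ => M.stress n h p ut ur z i.succ.succ 1) y = 0 := by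
    intro i
    have : i.succ.succ ≠ (1 : Fin (m + 4)) := fun h =>
      Fin.succ_ne_zero _ (Fin.succ_injective _ h)
    simp [stress_apply, radialField, this]
  have h0 := coordDeriv_comp (0 : Fin (m + 4)) 1
    (fun x => n x * h x * ut x * (M.g x * ur x)) y
  have h1 := coordDeriv_comp (1 : Fin (m + 4)) 1
    (fun x => n x * ur x * (h x * (M.g x * ur x)) + p x) y
  have e0 : (fun z => M.stress n h p ut ur z 0 1)
      = fun z => n (z 1) * h (z 1) * ut (z 1) * (M.g (z 1) * ur (z 1)) := by
    funext z
    have u1 : radialField ut ur z 1 = ur (z 1) := rfl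
    have u0 : radialField ut ur z 0 = ut (z 1) := rfl
    rw [stress_apply, if_neg n01, u1, u0, metricDiag_one]
    ring
  have e1 : (fun z => M.stress n h p ut ur z 1 1)
      = fun z => n (z 1) * ur (z 1) * (h (z 1) * (M.g (z 1) * ur (z 1))) + p (z 1) := by
    funext z
    have u1 : radialField ut ur z 1 = ur (z 1) := rfl
    rw [stress_apply, if_pos rfl, u1, metricDiag_one]
    ring
  rw [if_neg n01] at h0
  rw [if_pos rfl] at h1
  rw [Fin.sum_univ_succ, Fin.sum_univ_succ]
  simp only [h2, Finset.sum_const_zero, add_zero, Fin.succ_zero_eq_one]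
  rw [e0, e1, h0, h1, congrFun e1 y]
  simp only [christoffel_metric hy, coordDeriv_metricDiag_zero, coordDeriv_metricDiag_one, n01,
    n01.symm, if_true, if_false]
  simp only [metricDiag_zero, metricDiag_one, expansion]
  field_simp
  ring

lemma differentiableAt_f {r : ℝ} (hr : r ∈ M.radii) : DifferentiableAt ℝ M.f r :=
  (M.f_smooth.contDiffAt (M.isOpen_radii.mem_nhds hr)).differentiableAt (by norm_num)

lemma differentiableAt_g {r : ℝ} (hr : r ∈ M.radii) : DifferentiableAt ℝ M.g r :=
  (M.g_smooth.contDiffAt (M.isOpen_radii.mem_nhds hr)).differentiableAt (by norm_num)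

end StaticSpacetime

/-! ### Sound speed and elementary inequalities. -/

/-- `ln h` is affine in `ln n` with slope `γ - 1`, the inverse of the number of spatial dimensions.
-/
lemma soundSpeedSq_radiationEnthalpy (m : ℕ) {K n : ℝ} (hK : 0 < K) :
    soundSpeedSq (radiationEnthalpy m K) n = 1 / (m + 3) := by
  have hm : (m + 3 : ℝ) ≠ 0 := by positivity
  unfold soundSpeedSq
  have : (fun x => Real.log (radiationEnthalpy m K (Real.exp x)))
      = fun x => Real.log K + x * (1 / (m + 3)) := by
    funext x
    unfold radiationEnthalpy
    rw [← Real.exp_mul, Real.log_mul hK.ne' (Real.exp_pos _).ne', Real.log_exp]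
    congr 2
    field_simp
    ring
  rw [this]
  simp

/-- `w ↦ (w - 1) / w^N` is maximal at `w = N / (N - 1)`. -/
lemma sub_one_mul_pow_le {N : ℕ} (hN : 1 < N) {w : ℝ} (hw : 0 ≤ w) :
    (N - 1 : ℝ) * (w - 1) ≤ w ^ N * (1 - 1 / N) ^ N := by
  have hN0 : (0 : ℝ) < N := by positivity
  have hN1 : (1 : ℝ) / N ≤ 1 := by
    rw [div_le_one hN0]; exact_mod_cast hN.le
  -- Bernoulli's inequality at the point where its base `w (1 - 1 / N)` equals `1` exactly for the
  -- extremal `w`.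
  have h := one_add_mul_le_pow (a := w * (1 - 1 / N) - 1)
    (by nlinarith [mul_nonneg hw (sub_nonneg.2 hN1)]) N
  rw [add_sub_cancel, mul_pow] at h
  refine le_trans (le_of_eq ?_) h
  field_simp
  ring

lemma constant_of_deriv_eq_zero {s : Set ℝ} (ho : IsOpen s) (hs : s.OrdConnected) {F : ℝ → ℝ}
    (h : ∀ x ∈ s, HasDerivAt F 0 x) {x y : ℝ} (hx : x ∈ s) (hy : y ∈ s) : F x = F y := by
  exact hs.convex.is_const_of_fderivWithin_eq_zero (𝕜 := ℝ)
    (fun z hz => (h z hz).differentiableAt.differentiableWithinAt)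
    (fun z hz => by
      rw [fderivWithin_of_isOpen ho hz]
      ext
      simpa using (h z hz).deriv) hx hy

/-! ### First integrals of the flow and the maximum at a sonic point. -/

namespace RadiationFlow

open StaticSpacetime

variable {m : ℕ} {M : StaticSpacetime m} (Φ : RadiationFlow M) {r : ℝ}

lemma hasDerivAt_n (hr : r ∈ Φ.dom) : HasDerivAt Φ.n (deriv Φ.n r) r :=
  ((Φ.n_diff r hr).differentiableAt (Φ.isOpen_dom.mem_nhds hr)).hasDerivAt

lemma hasDerivAt_h (hr : r ∈ Φ.dom) : HasDerivAt Φ.h (deriv Φ.h r) r :=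
  ((Φ.h_diff r hr).differentiableAt (Φ.isOpen_dom.mem_nhds hr)).hasDerivAt

lemma hasDerivAt_p (hr : r ∈ Φ.dom) : HasDerivAt Φ.p (deriv Φ.p r) r :=
  ((Φ.p_diff r hr).differentiableAt (Φ.isOpen_dom.mem_nhds hr)).hasDerivAt

lemma hasDerivAt_S (hr : r ∈ Φ.dom) : HasDerivAt Φ.S (deriv Φ.S r) r :=
  ((Φ.S_diff r hr).differentiableAt (Φ.isOpen_dom.mem_nhds hr)).hasDerivAt

lemma hasDerivAt_ut (hr : r ∈ Φ.dom) : HasDerivAt Φ.ut (deriv Φ.ut r) r :=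
  ((Φ.ut_diff r hr).differentiableAt (Φ.isOpen_dom.mem_nhds hr)).hasDerivAt

lemma hasDerivAt_ur (hr : r ∈ Φ.dom) : HasDerivAt Φ.ur (deriv Φ.ur r) r :=
  ((Φ.ur_diff r hr).differentiableAt (Φ.isOpen_dom.mem_nhds hr)).hasDerivAt

lemma hasDerivAt_f (hr : r ∈ Φ.dom) : HasDerivAt M.f (deriv M.f r) r :=
  (differentiableAt_f (Φ.dom_subset hr)).hasDerivAt

lemma hasDerivAt_g (hr : r ∈ Φ.dom) : HasDerivAt M.g (deriv M.g r) r :=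
  (differentiableAt_g (Φ.dom_subset hr)).hasDerivAt

lemma deriv_flux (hr : r ∈ Φ.dom) :
    deriv Φ.n r * Φ.ur r + Φ.n r * deriv Φ.ur r = -M.expansion r * (Φ.n r * Φ.ur r) := by
  obtain ⟨y, hy, rfl⟩ := exists_mem_coordDomain (Φ.dom_subset hr)
  have h := Φ.continuity_eq y hy hr
  rw [divVector_radialField hy,
    ((Φ.hasDerivAt_n hr).fun_mul (Φ.hasDerivAt_ur hr)).deriv] at h
  linarith

lemma hasDerivAt_flux (hr : r ∈ Φ.dom) :
    HasDerivAt (fun x => Φ.n x * Φ.ur x) (-M.expansion r * (Φ.n r * Φ.ur r)) r :=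
  ((Φ.hasDerivAt_n hr).fun_mul (Φ.hasDerivAt_ur hr)).congr_deriv (Φ.deriv_flux hr)

/-- Where matter flows, the energy per particle is constant. -/
lemma deriv_energy (hr : r ∈ Φ.dom) (hur : Φ.ur r ≠ 0) :
    deriv Φ.h r * (M.f r * Φ.ut r)
      + Φ.h r * (deriv M.f r * Φ.ut r + M.f r * deriv Φ.ut r) = 0 := by
  obtain ⟨y, hy, rfl⟩ := exists_mem_coordDomain (Φ.dom_subset hr)
  have h := Φ.conservation y hy hr 0
  rw [divTensor_stress_zero hy, ((Φ.hasDerivAt_flux hr).fun_mul ((Φ.hasDerivAt_h hr).fun_mul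
    ((Φ.hasDerivAt_f hr).fun_mul (Φ.hasDerivAt_ut hr)))).deriv] at h
  have hn := (Φ.n_pos _ hr).ne'
  apply mul_left_cancel₀ (mul_ne_zero hn hur)
  linarith

/-- The entropy per particle is constant where matter flows. -/
lemma deriv_S (hr : r ∈ Φ.dom) (hur : Φ.ur r ≠ 0) : deriv Φ.S r = 0 := by
  have hE := Φ.deriv_energy hr hur
  have hN : deriv (fun x => -M.f x * Φ.ut x ^ 2 + M.g x * Φ.ur x ^ 2) r = 0 := by
    have : (fun x => -M.f x * Φ.ut x ^ 2 + M.g x * Φ.ur x ^ 2) =ᶠ[nhds r] fun _ => -1 := by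
      filter_upwards [Φ.isOpen_dom.mem_nhds hr] with x hx using Φ.normalized x hx
    rw [this.deriv_eq, deriv_const]
  rw [(((Φ.hasDerivAt_f hr).fun_neg.fun_mul ((Φ.hasDerivAt_ut hr).fun_pow 2)).fun_add
    ((Φ.hasDerivAt_g hr).fun_mul ((Φ.hasDerivAt_ur hr).fun_pow 2))).deriv] at hN
  have hnorm := Φ.normalized r hr
  have hfl := Φ.first_law r hr
  have hn := (Φ.n_pos r hr).ne'
  -- The differentiated normalization and the energy equation remove the derivatives of the velocity
  -- and the metric from the momentum equation. What is left is `dp = n dh`, so the first law forces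
  -- `T dS = 0`.
  have hEuler : deriv Φ.p r = Φ.n r * deriv Φ.h r := by
    obtain ⟨y, hy, rfl⟩ := exists_mem_coordDomain (Φ.dom_subset hr)
    have h := Φ.conservation y hy hr 1
    rw [divTensor_stress_one hy, (((Φ.hasDerivAt_flux hr).fun_mul ((Φ.hasDerivAt_h hr).fun_mul
      ((Φ.hasDerivAt_g hr).fun_mul (Φ.hasDerivAt_ur hr)))).fun_add (Φ.hasDerivAt_p hr)).deriv] at h
    push_cast at hN
    linear_combination h + Φ.n (y 1) * Φ.h (y 1) / 2 * (-1) * hN - Φ.n (y 1) * Φ.ut (y 1) * hE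
      - Φ.n (y 1) * deriv Φ.h (y 1) * hnorm
  rw [hEuler, inv_mul_cancel_left₀ hn] at hfl
  have : Φ.T r * deriv Φ.S r = 0 := by linarith
  exact (mul_eq_zero.1 this).resolve_left (Φ.T_pos r hr).ne'

/-- `expansion` is the logarithmic derivative of `√(f g) r^(m+2)`; squaring the conserved flux
avoids the root. -/
lemma flux_sq_const {r₀ : ℝ} (hr : r ∈ Φ.dom) (hr₀ : r₀ ∈ Φ.dom) :
    (Φ.n r * Φ.ur r) ^ 2 * (M.f r * M.g r * r ^ (2 * (m + 2)))
      = (Φ.n r₀ * Φ.ur r₀) ^ 2 * (M.f r₀ * M.g r₀ * r₀ ^ (2 * (m + 2))) := by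
  refine constant_of_deriv_eq_zero Φ.isOpen_dom Φ.ordConnected_dom
    (F := fun r => (Φ.n r * Φ.ur r) ^ 2 * (M.f r * M.g r * r ^ (2 * (m + 2))))
    (fun x hx => ?_) hr hr₀
  refine (((Φ.hasDerivAt_flux hx).fun_pow 2).fun_mul (((Φ.hasDerivAt_f hx).fun_mul
    (Φ.hasDerivAt_g hx)).fun_mul (hasDerivAt_pow (2 * (m + 2)) x))).congr_deriv ?_
  have hf := (M.f_pos _ (Φ.dom_subset hx)).ne'
  have hg := (M.g_pos _ (Φ.dom_subset hx)).ne'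
  have hx0 := (M.radii_pos _ (Φ.dom_subset hx)).ne'
  unfold expansion
  have : x ^ (2 * (m + 2)) = x ^ (2 * (m + 2) - 1) * x := by
    rw [← pow_succ]; congr 1
  rw [this]
  push_cast
  field_simp
  ring

lemma K_pos (hr : r ∈ Φ.dom) : 0 < Φ.K (Φ.S r) := by
  have h := Φ.h_pos r hr
  rw [Φ.eos r hr, radiationEnthalpy] at h
  exact pos_of_mul_pos_left h (Real.rpow_pos_of_pos (Φ.n_pos r hr) _).le

/-- Since `γ - 1 = 1 / (m + 3)`, this power clears the real exponent and the later elimination is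
polynomial. -/
lemma h_pow (hr : r ∈ Φ.dom) : Φ.h r ^ (m + 3) = Φ.K (Φ.S r) ^ (m + 3) * Φ.n r := by
  have hm : (m + 3 : ℝ) ≠ 0 := by positivity
  rw [Φ.eos r hr, radiationEnthalpy, mul_pow, ← Real.rpow_natCast (Φ.n r ^ _),
    ← Real.rpow_mul (Φ.n_pos r hr).le]
  have : (((m + 3 : ℝ) + 1) / (m + 3 : ℝ) - 1) * ((m + 3 : ℕ) : ℝ) = 1 := by
    push_cast
    field_simp
    ring
  rw [this, Real.rpow_one]

lemma velocitySq_eq (hr : r ∈ Φ.dom) : Φ.velocitySq r = 1 - 1 / (M.f r * Φ.ut r ^ 2) := by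
  have hf := M.f_pos _ (Φ.dom_subset hr)
  have hs := Real.sq_sqrt hf.le
  have hs0 := (Real.sqrt_pos.2 hf).ne'
  unfold velocitySq
  congr 2
  rw [mul_pow, mul_pow, one_div, inv_pow, hs]
  field_simp

/-- From `1 - 1 / w = 1 / N` with `w = f (u^t)²`: the Lorentz factor at a sonic point depends on the
dimension alone. -/
lemma IsSonicRadius.gamma_sq {Φ : RadiationFlow M} (h : Φ.IsSonicRadius r) :
    ((m + 3 : ℕ) - 1 : ℝ) * (M.f r * Φ.ut r ^ 2) = (m + 3 : ℕ) := by
  obtain ⟨hr, h⟩ := h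
  have hf := M.f_pos _ (Φ.dom_subset hr)
  have hu := Φ.ut_pos _ hr
  have hm : (m + 3 : ℝ) ≠ 0 := by positivity
  rw [Φ.velocitySq_eq hr, soundSq, soundSpeedSq_radiationEnthalpy m (Φ.K_pos hr)] at h
  push_cast
  field_simp at h
  linarith

/-- The function `f / r²` is maximal at a sonic point. -/
lemma IsSonicRadius.isMax {Φ : RadiationFlow M} {r₀ : ℝ} (h : Φ.IsSonicRadius r₀)
    (hr : r ∈ Φ.dom) : M.f r / r ^ 2 ≤ M.f r₀ / r₀ ^ 2 := by
  have hr₀ := h.1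
  have hw₀ := h.gamma_sq
  have hfp : ∀ x ∈ Φ.dom, 0 < M.f x := fun x hx => M.f_pos _ (Φ.dom_subset hx)
  have hgp : ∀ x ∈ Φ.dom, 0 < M.g x := fun x hx => M.g_pos _ (Φ.dom_subset hx)
  have hxp : ∀ x ∈ Φ.dom, 0 < x := fun x hx => M.radii_pos _ (Φ.dom_subset hx)
  have hw1 : ∀ x ∈ Φ.dom, M.g x * Φ.ur x ^ 2 = M.f x * Φ.ut x ^ 2 - 1 := fun x hx => by
    linarith [Φ.normalized x hx]
  set w : ℝ → ℝ := fun x => M.f x * Φ.ut x ^ 2 with hw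
  have hwp : ∀ x ∈ Φ.dom, 0 < w x := fun x hx => mul_pos (hfp x hx) (pow_pos (Φ.ut_pos x hx) 2)
  change ((m + 3 : ℕ) - 1 : ℝ) * w r₀ = (m + 3 : ℕ) at hw₀
  set J : ℝ := (Φ.n r₀ * Φ.ur r₀) ^ 2 * (M.f r₀ * M.g r₀ * r₀ ^ (2 * (m + 2))) with hJ
  have hJc : ∀ x ∈ Φ.dom, Φ.n x ^ 2 * (w x - 1) * (M.f x * x ^ (2 * (m + 2))) = J := by
    intro x hx
    rw [hJ, ← Φ.flux_sq_const hx hr₀]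
    linear_combination (-Φ.n x ^ 2 * (M.f x * x ^ (2 * (m + 2)))) * hw1 x hx
  have hw₀1 : 1 < w r₀ := by
    push_cast at hw₀
    nlinarith [hwp r₀ hr₀]
  have hJpos : 0 < J := by
    rw [← hJc r₀ hr₀]
    have := hfp r₀ hr₀; have := hxp r₀ hr₀; have := Φ.n_pos r₀ hr₀
    have := sub_pos.2 hw₀1
    positivity
  -- Matter moves at the sonic point, since `w r₀ > 1`. Flux conservation then forbids rest
  -- anywhere, so the energy per particle and the entropy are constant on the whole domain.
  have hur : ∀ x ∈ Φ.dom, Φ.ur x ≠ 0 := by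
    intro x hx h0
    have := Φ.flux_sq_const hx hr₀
    rw [← hJ, h0] at this
    simp at this
    exact hJpos.ne this
  have hE : ∀ x ∈ Φ.dom, Φ.h x * (M.f x * Φ.ut x) = Φ.h r₀ * (M.f r₀ * Φ.ut r₀) := fun x hx =>
    constant_of_deriv_eq_zero Φ.isOpen_dom Φ.ordConnected_dom
      (F := fun x => Φ.h x * (M.f x * Φ.ut x)) (fun z hz =>
        ((Φ.hasDerivAt_h hz).fun_mul ((Φ.hasDerivAt_f hz).fun_mul
          (Φ.hasDerivAt_ut hz))).congr_deriv (Φ.deriv_energy hz (hur z hz))) hx hr₀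
  have hS : ∀ x ∈ Φ.dom, Φ.S x = Φ.S r₀ := fun x hx =>
    constant_of_deriv_eq_zero Φ.isOpen_dom Φ.ordConnected_dom (fun z hz =>
      (Φ.hasDerivAt_S hz).congr_deriv (Φ.deriv_S hz (hur z hz))) hx hr₀
  set E : ℝ := Φ.h r₀ * (M.f r₀ * Φ.ut r₀) with hEdef
  set κ : ℝ := Φ.K (Φ.S r₀) with hκ
  have hκp : 0 < κ := Φ.K_pos hr₀
  have hEp : 0 < E := mul_pos (Φ.h_pos r₀ hr₀) (mul_pos (hfp r₀ hr₀) (Φ.ut_pos r₀ hr₀))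
  -- `n` and `h` are eliminated between flux, energy and equation of state; `g` drops out because `g
  -- (u^r)² = w - 1`.
  have key : ∀ x ∈ Φ.dom, E ^ (2 * (m + 3)) * (w x - 1)
      = κ ^ (2 * (m + 3)) * J * (M.f x / x ^ 2) ^ (m + 2) * w x ^ (m + 3) := by
    intro x hx
    have h1 : E ^ (2 * (m + 3)) = κ ^ (2 * (m + 3)) * Φ.n x ^ 2 * (M.f x * w x) ^ (m + 3) := by
      calc E ^ (2 * (m + 3)) = (Φ.h x ^ (m + 3)) ^ 2 * ((M.f x * Φ.ut x) ^ 2) ^ (m + 3) := by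
            rw [← hE x hx]; ring
        _ = _ := by
            rw [Φ.h_pow hx, hS x hx, ← hκ, hw]; ring
    have hx0 := (hxp x hx).ne'
    rw [h1, ← hJc x hx]
    have : (M.f x / x ^ 2) ^ (m + 2) = M.f x ^ (m + 2) / x ^ (2 * (m + 2)) := by
      rw [div_pow, ← pow_mul]
    rw [this]
    field_simp
    ring
  have hq : ∀ x ∈ Φ.dom, 0 < M.f x / x ^ 2 := fun x hx => div_pos (hfp x hx) (pow_pos (hxp x hx) 2)
  refine le_of_pow_le_pow_left₀ (n := m + 2) (by omega) (hq r₀ hr₀).le ?_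
  have hC : 0 < κ ^ (2 * (m + 3)) * J := by positivity
  have hk := key r hr
  have hk₀ := key r₀ hr₀
  have hwr := hwp r hr
  set N : ℕ := m + 3 with hN
  have hN1 : 1 < N := by omega
  have hNr : (0 : ℝ) < (N : ℝ) - 1 := by
    have : (1 : ℝ) < N := by exact_mod_cast hN1
    linarith
  have hb := sub_one_mul_pow_le hN1 hwr.le
  have hb₀ : ((N : ℝ) - 1) * (w r₀ - 1) = w r₀ ^ N * (1 - 1 / N) ^ N := by
    have hNne : (N : ℝ) ≠ 0 := by linarith
    rw [← mul_pow]
    have : w r₀ * (1 - 1 / N) = 1 := by field_simp; linarith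
    rw [this, one_pow]; linarith
  have hP : (0 : ℝ) < (1 - 1 / N) ^ N := by
    apply pow_pos
    rw [sub_pos, div_lt_one (by linarith)]; linarith
  have hEE : 0 < E ^ (2 * N) := pow_pos hEp _
  -- Inserting the bound on `(w - 1) / w^N` into `key` gives equality at `r₀` and an inequality at
  -- `r`, with the same right side.
  have a1 : κ ^ (2 * N) * J * (M.f r₀ / r₀ ^ 2) ^ (m + 2) * ((N : ℝ) - 1)
      = E ^ (2 * N) * (1 - 1 / N) ^ N := by
    have hpw : w r₀ ^ N ≠ 0 := (pow_pos (hwp r₀ hr₀) N).ne'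
    apply mul_right_cancel₀ hpw
    linear_combination (-((N : ℝ) - 1)) * hk₀ + E ^ (2 * N) * hb₀
  have a2 : κ ^ (2 * N) * J * (M.f r / r ^ 2) ^ (m + 2) * ((N : ℝ) - 1)
      ≤ E ^ (2 * N) * (1 - 1 / N) ^ N := by
    refine le_of_mul_le_mul_right ?_ (pow_pos hwr N)
    have := mul_le_mul_of_nonneg_left hb hEE.le
    linear_combination this + (-((N : ℝ) - 1)) * hk
  rw [← a1] at a2
  exact le_of_mul_le_mul_left (le_of_mul_le_mul_right a2 hNr) hC

end RadiationFlow

/-! ### Integrating the radial equation. -/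

/-- A continuous function on an open interval around `0` has a primitive. -/
lemma exists_primitive {F : ℝ → ℝ} {a b : ℝ} (h0 : (0 : ℝ) ∈ Set.Ioo a b)
    (hF : ContinuousOn F (Set.Ioo a b)) :
    ∃ G : ℝ → ℝ, G 0 = 0 ∧ ∀ τ ∈ Set.Ioo a b, HasDerivAt G (F τ) τ := by
  refine ⟨fun τ => ∫ x in (0 : ℝ)..τ, F x, intervalIntegral.integral_same, fun τ hτ => ?_⟩
  refine intervalIntegral.integral_hasDerivAt_right
    (hF.mono (Set.ordConnected_Ioo.uIcc_subset h0 hτ)).intervalIntegrable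
    (hF.stronglyMeasurableAtFilter isOpen_Ioo τ hτ)
    (hF.continuousAt (isOpen_Ioo.mem_nhds hτ))

/-- The solution of `R' = V(R)` through `r₀` traverses an interval on which `V` is positive. -/
lemma exists_autonomous_solution {V : ℝ → ℝ} {r₀ ε : ℝ} (hε : 0 < ε)
    (hV : ContinuousOn V (Set.Icc (r₀ - ε) (r₀ + ε)))
    (pos : ∀ x ∈ Set.Icc (r₀ - ε) (r₀ + ε), 0 < V x) :
    ∃ (R : ℝ → ℝ) (a b : ℝ), a < 0 ∧ 0 < b ∧ R 0 = r₀ ∧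
      (∀ τ ∈ Set.Ioo a b, R τ ∈ Set.Ioo (r₀ - ε) (r₀ + ε) ∧ HasDerivAt R (V (R τ)) τ) ∧
      ∃ τ ∈ Set.Ico 0 b, R τ = r₀ + ε / 2 := by
  -- Clamping the argument extends `V` to a positive bounded speed on the line. The travel time `T`
  -- then grows at least linearly, hence is a bijection, and its inverse is the solution.
  set cl : ℝ → ℝ := fun x => max (r₀ - ε) (min (r₀ + ε) x) with hcl
  have hclc : Continuous cl := by fun_prop
  have hclm : ∀ x, cl x ∈ Set.Icc (r₀ - ε) (r₀ + ε) := fun x =>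
    ⟨le_max_left _ _, max_le (by linarith) (min_le_left _ _)⟩
  have hclid : ∀ x ∈ Set.Icc (r₀ - ε) (r₀ + ε), cl x = x := fun x hx => by
    rw [hcl]; simp [hx.1, hx.2]
  set W : ℝ → ℝ := fun x => (V (cl x))⁻¹ with hW
  have hWc : Continuous W := (hV.comp_continuous hclc hclm).inv₀ fun x => (pos _ (hclm x)).ne'
  have hWp : ∀ x, 0 < W x := fun x => inv_pos.2 (pos _ (hclm x))
  obtain ⟨z, hz, hzmax⟩ := isCompact_Icc.exists_isMaxOn
    (Set.nonempty_Icc.2 (by linarith : r₀ - ε ≤ r₀ + ε)) hV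
  set c : ℝ := (V z)⁻¹ with hc
  have hcp : 0 < c := inv_pos.2 (pos z hz)
  have hcW : ∀ x, c ≤ W x := fun x => inv_anti₀ (pos _ (hclm x)) (hzmax (hclm x))
  set T : ℝ → ℝ := fun x => ∫ y in r₀..x, W y with hT
  have hTd : ∀ x, HasDerivAt T (W x) x := fun x => (hWc.integral_hasStrictDerivAt r₀ x).hasDerivAt
  have hTmono : StrictMono T := strictMono_of_deriv_pos fun x => by
    rw [(hTd x).deriv]; exact hWp x
  have hT0 : T r₀ = 0 := intervalIntegral.integral_same
  have hGmono : Monotone fun x => T x - c * x := by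
    have hd : ∀ x, HasDerivAt (fun x => T x - c * x) (W x - c) x := fun x =>
      ((hTd x).fun_sub ((hasDerivAt_id x).const_mul c)).congr_deriv (by rw [mul_one])
    exact monotone_of_deriv_nonneg (fun x => (hd x).differentiableAt) fun x => by
      rw [(hd x).deriv]; exact sub_nonneg.2 (hcW x)
  have hTsurj : Function.Surjective T := by
    refine (continuous_iff_continuousAt.2 fun x => (hTd x).continuousAt).surjective ?_ ?_
    · refine Filter.tendsto_atTop_mono' (f₁ := fun x => c * x + (T r₀ - c * r₀)) _ ?_
        (Filter.tendsto_atTop_add_const_right _ _ (Filter.tendsto_id.const_mul_atTop hcp))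
      filter_upwards [Filter.eventually_ge_atTop r₀] with x hx
      have := hGmono hx
      simp only at this
      linarith
    · refine Filter.tendsto_atBot_mono' (f₁ := fun x => c * x + (T r₀ - c * r₀)) _ ?_
        (Filter.tendsto_atBot_add_const_right _ _ (Filter.tendsto_id.const_mul_atBot hcp))
      filter_upwards [Filter.eventually_le_atBot r₀] with x hx
      have := hGmono hx
      simp only at this
      linarith
  set Ψ : ℝ ≃o ℝ := hTmono.orderIsoOfSurjective T hTsurj with hΨ
  have hTR : ∀ τ, T (Ψ.symm τ) = τ := fun τ => Ψ.apply_symm_apply τ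
  have hRT : ∀ x, Ψ.symm (T x) = x := fun x => Ψ.symm_apply_apply x
  refine ⟨Ψ.symm, T (r₀ - ε), T (r₀ + ε), ?_, ?_, ?_, ?_, T (r₀ + ε / 2), ⟨?_, ?_⟩, hRT _⟩
  · rw [← hT0]; exact hTmono (by linarith)
  · rw [← hT0]; exact hTmono (by linarith)
  · rw [← hT0, hRT]
  · intro τ hτ
    have hmem : Ψ.symm τ ∈ Set.Ioo (r₀ - ε) (r₀ + ε) := by
      constructor
      · rw [← hTmono.lt_iff_lt, hTR]; exact hτ.1
      · rw [← hTmono.lt_iff_lt, hTR]; exact hτ.2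
    refine ⟨hmem, ?_⟩
    have := HasDerivAt.of_local_left_inverse (Ψ.symm.continuous.continuousAt (x := τ))
      (hTd (Ψ.symm τ)) (hWp _).ne' (Filter.Eventually.of_forall hTR)
    rwa [hW, inv_inv, hclid _ (Set.Ioo_subset_Icc_self hmem)] at this
  · rw [← hT0]; exact (hTmono (by linarith)).le
  · exact hTmono (by linarith)

/-! ### Circular and escaping null orbits. -/

namespace StaticSpacetime

variable {m : ℕ} {M : StaticSpacetime m}

/-- Where `f / r²` is maximal, null geodesics with a positive radial velocity run away. -/
lemma exists_escaping_geodesic {r₀ ε : ℝ} (hε : 0 < ε)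
    (hsub : Set.Icc (r₀ - ε) (r₀ + ε) ⊆ M.radii)
    (hmax : ∀ x ∈ Set.Icc (r₀ - ε) (r₀ + ε), M.f x / x ^ 2 ≤ M.f r₀ / r₀ ^ 2)
    {X U : Fin (m + 3) → ℝ} (hX : X ∈ M.sym.space m) (hU : U ∈ M.sym.tangent X)
    (h1 : M.sym.form U U = 1) (t₀ : ℝ) {T₀ v₀ κ : ℝ} (hv : 0 < v₀) (hκ : 0 < κ)
    (null : M.f r₀ * T₀ ^ 2 = M.g r₀ * v₀ ^ 2 + r₀ ^ 2 * κ ^ 2) :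
    ∃ (η : ℝ → STPoint m) (a b : ℝ), a < 0 ∧ 0 < b ∧ M.IsNullGeodesic η a b ∧
      η 0 = (t₀, r₀, X) ∧ HasDerivAt η (T₀, v₀, κ • U) 0 ∧
      ∃ τ ∈ Set.Ico 0 b, (η τ).2.1 = r₀ + ε / 2 := by
  have hr₀ : r₀ ∈ Set.Icc (r₀ - ε) (r₀ + ε) := ⟨by linarith, by linarith⟩
  have hx0 : ∀ x ∈ Set.Icc (r₀ - ε) (r₀ + ε), 0 < x := fun x hx => M.radii_pos x (hsub hx)
  have hf : ∀ x ∈ Set.Icc (r₀ - ε) (r₀ + ε), 0 < M.f x := fun x hx => M.f_pos x (hsub hx)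
  have hg : ∀ x ∈ Set.Icc (r₀ - ε) (r₀ + ε), 0 < M.g x := fun x hx => M.g_pos x (hsub hx)
  -- `E` and `L` are the conserved energy and angular momentum; `Q` is the value of `r'²` that the
  -- null condition prescribes.
  set E : ℝ := M.f r₀ * T₀ with hE
  set L : ℝ := r₀ ^ 2 * κ with hL
  have h00 := hx0 r₀ hr₀
  have hLp : 0 < L := by positivity
  set Q : ℝ → ℝ := fun x => (E ^ 2 - L ^ 2 * (M.f x / x ^ 2)) / (M.f x * M.g x) with hQ
  have hQ₀ : Q r₀ = v₀ ^ 2 := by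
    have := (hf r₀ hr₀).ne'
    have := (hg r₀ hr₀).ne'
    rw [hQ, hE, hL]
    field_simp
    linear_combination null
  have hQp : ∀ x ∈ Set.Icc (r₀ - ε) (r₀ + ε), 0 < Q x := by
    intro x hx
    refine div_pos ?_ (mul_pos (hf x hx) (hg x hx))
    -- The initial `r'` is nonzero, so the energy exceeds the top of the barrier at `r₀`, hence the
    -- potential on the whole interval: there is no turning point.
    have h2 : 0 < E ^ 2 - L ^ 2 * (M.f r₀ / r₀ ^ 2) := by
      have h3 : 0 < Q r₀ := by rw [hQ₀]; positivity
      exact (div_pos_iff_of_pos_right (mul_pos (hf r₀ hr₀) (hg r₀ hr₀))).1 h3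
    have := mul_le_mul_of_nonneg_left (hmax x hx) (sq_nonneg L)
    linarith
  -- Differentiating `r'² = Q(r)` gives `r'' = Q'(r) / 2`, so half of this derivative is the
  -- geodesic radial acceleration.
  have hQd : ∀ x ∈ Set.Icc (r₀ - ε) (r₀ + ε), HasDerivAt Q
      (2 * (-(deriv M.f x / (2 * M.g x)) * (E / M.f x) ^ 2
        - deriv M.g x / (2 * M.g x) * Q x + x / M.g x * (L / x ^ 2) ^ 2)) x := by
    intro x hx
    have df := (differentiableAt_f (hsub hx)).hasDerivAt
    have dg := (differentiableAt_g (hsub hx)).hasDerivAt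
    have hf' := (hf x hx).ne'
    have hg' := (hg x hx).ne'
    have hx' := (hx0 x hx).ne'
    refine ((((df.fun_div (hasDerivAt_pow 2 x) (pow_ne_zero 2 hx')).const_mul (L ^ 2)).const_sub
      (E ^ 2)).fun_div (df.fun_mul dg) (mul_ne_zero hf' hg')).congr_deriv ?_
    rw [hQ]
    field_simp
    ring
  set V : ℝ → ℝ := fun x => Real.sqrt (Q x) with hV
  have hVp : ∀ x ∈ Set.Icc (r₀ - ε) (r₀ + ε), 0 < V x := fun x hx => Real.sqrt_pos.2 (hQp x hx)
  have hVsq : ∀ x ∈ Set.Icc (r₀ - ε) (r₀ + ε), V x ^ 2 = Q x := fun x hx =>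
    Real.sq_sqrt (hQp x hx).le
  obtain ⟨R, a, b, ha, hb, hR0, hR, hesc⟩ := exists_autonomous_solution hε
    (fun x hx => (hQd x hx).continuousAt.continuousWithinAt.sqrt) hVp
  have hRI : ∀ τ ∈ Set.Ioo a b, R τ ∈ Set.Icc (r₀ - ε) (r₀ + ε) := fun τ hτ =>
    Set.Ioo_subset_Icc_self (hR τ hτ).1
  have dft : ∀ τ ∈ Set.Ioo a b, HasDerivAt (fun τ => E / M.f (R τ))
      (-(deriv M.f (R τ) / M.f (R τ)) * V (R τ) * (E / M.f (R τ))) τ := by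
    intro τ hτ
    have hf' := (hf _ (hRI τ hτ)).ne'
    refine ((hasDerivAt_const τ E).fun_div
      ((differentiableAt_f (hsub (hRI τ hτ))).hasDerivAt.comp τ (hR τ hτ).2) hf').congr_deriv ?_
    simp only [Function.comp]
    field_simp
    ring
  have dfφ : ∀ τ ∈ Set.Ioo a b, HasDerivAt (fun τ => L / R τ ^ 2)
      (-(2 / R τ) * V (R τ) * (L / R τ ^ 2)) τ := by
    intro τ hτ
    have hx' := (hx0 _ (hRI τ hτ)).ne'
    refine ((hasDerivAt_const τ L).fun_div ((hR τ hτ).2.fun_pow 2)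
      (pow_ne_zero 2 hx')).congr_deriv ?_
    field_simp
    ring
  have h0 : (0 : ℝ) ∈ Set.Ioo a b := ⟨ha, hb⟩
  obtain ⟨G, hG0, hG⟩ := exists_primitive h0
    fun τ hτ => (dft τ hτ).continuousAt.continuousWithinAt
  obtain ⟨φ, hφ0, hφ⟩ := exists_primitive h0
    fun τ hτ => (dfφ τ hτ).continuousAt.continuousWithinAt
  refine ⟨fun τ => (t₀ + G τ, R τ, M.sym.c (φ τ) • X + M.sym.s (φ τ) • U), a, b, ha, hb,
    isNullGeodesic_of hX hU h1 (t' := fun τ => E / M.f (R τ)) (r' := fun τ => V (R τ))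
      (φ' := fun τ => L / R τ ^ 2) (fun τ hτ => hsub (hRI τ hτ)) (fun τ hτ => (hG τ hτ).const_add t₀)
      (fun τ hτ => (hR τ hτ).2) hφ dft ?_ dfφ ?_ ?_, ?_, ?_, hesc⟩
  · intro τ hτ
    have hVne := (hVp _ (hRI τ hτ)).ne'
    refine (((hQd _ (hRI τ hτ)).sqrt (hQp _ (hRI τ hτ)).ne').comp τ (hR τ hτ).2).congr_deriv ?_
    rw [hVsq _ (hRI τ hτ)]
    change _ / (2 * V (R τ)) * V (R τ) = _
    field_simp
  · intro τ hτ
    exact (div_pos hLp (pow_pos (hx0 _ (hRI τ hτ)) 2)).ne'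
  · intro τ hτ
    have hf' := (hf _ (hRI τ hτ)).ne'
    have hg' := (hg _ (hRI τ hτ)).ne'
    have hx' := (hx0 _ (hRI τ hτ)).ne'
    rw [hVsq _ (hRI τ hτ), hQ]
    field_simp
    ring
  · simp [hG0, hR0, hφ0]
  · have hf' := (hf r₀ hr₀).ne'
    refine (((hG 0 h0).const_add t₀).prodMk ((hR 0 h0).2.prodMk
      (SpatialSymmetry.hasDerivAt_add_smul X U (hφ 0 h0)))).congr_deriv ?_
    have hV0 : V r₀ = v₀ := by rw [hV]; simp only [hQ₀]; exact Real.sqrt_sq hv.le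
    have e1 : E / M.f r₀ = T₀ := by rw [hE]; field_simp
    have e2 : L / r₀ ^ 2 = κ := by rw [hL]; field_simp
    simp [hφ0, hR0, show Real.sqrt (Q r₀) = v₀ from hV0, e1, e2]

/-- The unit vector along the spatial part of a null vector tangent to a surface of constant
radius. -/
lemma exists_unit_direction {r : ℝ} (hr : r ∈ M.radii) {X : Fin (m + 3) → ℝ}
    (hX : X ∈ M.sym.space m) {k : STPoint m} (hk1 : k.2.1 = 0) (hk : k.2.2 ∈ M.sym.tangent X)
    (hk0 : k ≠ 0) (hnull : M.normSq r k = 0) :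
    ∃ (κ : ℝ) (U : Fin (m + 3) → ℝ), 0 < κ ∧ U ∈ M.sym.tangent X ∧ M.sym.form U U = 1 ∧
      k.2.2 = κ • U ∧ M.f r * k.1 ^ 2 = r ^ 2 * κ ^ 2 ∧ k.1 ≠ 0 := by
  have hf := M.f_pos r hr
  have hr0 := M.radii_pos r hr
  rw [normSq, hk1] at hnull
  have hK : k.2.2 ≠ 0 := by
    intro hK
    have h0 : M.sym.form k.2.2 k.2.2 = 0 := by rw [hK]; simp [SpatialSymmetry.form]
    rw [h0] at hnull
    have : M.f r * k.1 ^ 2 = 0 := by linarith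
    have := pow_eq_zero_iff two_ne_zero |>.1 ((mul_eq_zero.1 this).resolve_left hf.ne')
    exact hk0 (Prod.ext this (Prod.ext hk1 hK))
  have hpos := SpatialSymmetry.form_self_pos hX hk hK
  set κ := Real.sqrt (M.sym.form k.2.2 k.2.2) with hκ
  have hκp : 0 < κ := Real.sqrt_pos.2 hpos
  have hκ2 : κ ^ 2 = M.sym.form k.2.2 k.2.2 := Real.sq_sqrt hpos.le
  have hn : M.f r * k.1 ^ 2 = r ^ 2 * κ ^ 2 := by rw [hκ2]; linarith
  refine ⟨κ, κ⁻¹ • k.2.2, hκp, ?_, ?_, ?_, hn, ?_⟩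
  · rw [SpatialSymmetry.mem_tangent_iff] at *
    exact Submodule.smul_mem _ _ hk
  · rw [SpatialSymmetry.form_smul_left, SpatialSymmetry.form_smul_right, ← hκ2]
    field_simp
  · rw [smul_inv_smul₀ hκp.ne']
  · intro h
    rw [h] at hn
    have : 0 < r ^ 2 * κ ^ 2 := by positivity
    rw [← hn] at this
    simp at this

/-- The circular null orbits at a critical point of `f / r²`. -/
lemma isPhotonSurface_of_deriv_eq_zero {r : ℝ} (hr : r ∈ M.radii)
    (hd : deriv (fun x => M.f x / x ^ 2) r = 0) : M.IsPhotonSurface r := by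
  have hf := (M.f_pos r hr).ne'
  have hg := (M.g_pos r hr).ne'
  have hr0 := (M.radii_pos r hr).ne'
  -- Criticality of `f / r²`. Together with the null condition it balances the `t'²` and `φ'²` terms
  -- of the radial equation.
  have hf' : deriv M.f r * r = 2 * M.f r := by
    rw [((differentiableAt_f hr).hasDerivAt.fun_div (hasDerivAt_pow 2 r)
      (pow_ne_zero 2 hr0)).deriv] at hd
    have hd := (div_eq_zero_iff.1 hd).resolve_right (pow_ne_zero 2 (pow_ne_zero 2 hr0))
    apply mul_left_cancel₀ hr0
    push_cast at hd
    linear_combination hd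
  refine ⟨hr, fun t X hX k hk1 hk hk0 hnull => ?_⟩
  obtain ⟨κ, U, hκ, hU, hUU, hkU, hn, -⟩ := exists_unit_direction hr hX hk1 hk hk0 hnull
  have dt : ∀ τ : ℝ, HasDerivAt (fun τ => t + k.1 * τ) k.1 τ := fun τ => by
    simpa using ((hasDerivAt_id τ).const_mul k.1).const_add t
  have dφ : ∀ τ : ℝ, HasDerivAt (fun τ => κ * τ) κ τ := fun τ => by
    simpa using (hasDerivAt_id τ).const_mul κ
  refine ⟨1, one_pos, fun τ => (t + k.1 * τ, r, M.sym.c (κ * τ) • X + M.sym.s (κ * τ) • U),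
    isNullGeodesic_of hX hU hUU (r := fun _ => r) (t' := fun _ => k.1) (r' := fun _ => 0)
      (φ' := fun _ => κ) (fun _ _ => hr) (fun τ _ => dt τ) (fun τ _ => hasDerivAt_const _ _)
      (fun τ _ => dφ τ) (fun τ _ => (hasDerivAt_const _ _).congr_deriv (by ring))
      (fun τ _ => (hasDerivAt_const _ _).congr_deriv ?_)
      (fun τ _ => (hasDerivAt_const _ _).congr_deriv (by ring)) (fun _ _ => hκ.ne')
      (fun _ _ => by linear_combination -hn), by simp, ?_, fun _ _ => rfl⟩
  · field_simp
    apply mul_left_cancel₀ hr0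
    linear_combination k.1 ^ 2 * hf' + 2 * hn
  · refine ((dt 0).prodMk ((hasDerivAt_const _ _).prodMk
      (SpatialSymmetry.hasDerivAt_add_smul X U (dφ 0)))).congr_deriv ?_
    refine Prod.ext rfl (Prod.ext hk1.symm ?_)
    simp [hkU]

/-- A local maximum of `f / r²` is not a stable orbit. -/
lemma not_isStableOrbit_of_isLocalMax {r : ℝ} (hr : r ∈ M.radii)
    (hmax : IsLocalMax (fun x => M.f x / x ^ 2) r) {γ : ℝ → STPoint m} {a b : ℝ} (ha : a < 0)
    (hb : 0 < b) (hγ : M.IsNullGeodesic γ a b) (hγr : ∀ τ ∈ Set.Ioo a b, (γ τ).2.1 = r) :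
    ¬ M.IsStableOrbit γ := by
  intro hst
  have h0 : (0 : ℝ) ∈ Set.Ioo a b := ⟨ha, hb⟩
  have hf := M.f_pos r hr
  have hg := M.g_pos r hr
  obtain ⟨-, hX, k, hk, hkt, hk0, hnull⟩ := hγ.exists_velocity h0
  have hk1 : k.2.1 = 0 := by
    have h1 : HasDerivAt (fun τ => (γ τ).2.1) k.2.1 0 := hk.snd.fst
    have h2 : (fun τ => (γ τ).2.1) =ᶠ[nhds 0] fun _ => r := by
      filter_upwards [isOpen_Ioo.mem_nhds h0] with τ hτ using hγr τ hτ
    exact h1.unique ((hasDerivAt_const 0 r).congr_of_eventuallyEq h2)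
  rw [hγr 0 h0] at hnull
  obtain ⟨κ, U, hκ, hU, hUU, hkU, hn, hkt0⟩ := exists_unit_direction hr hX hk1 hkt hk0 hnull
  obtain ⟨ε, hε, hball⟩ := Metric.nhds_basis_closedBall.mem_iff.1
    (Filter.inter_mem (M.isOpen_radii.mem_nhds hr) hmax)
  rw [Real.closedBall_eq_Icc] at hball
  obtain ⟨δ, hδ, H⟩ := hst (ε / 2) (by linarith)
  -- The perturbation multiplies `k^t` by `1 + θ`, keeps the spatial part, and takes the radial
  -- velocity that restores nullity. Both changes tend to `0` with `θ`, while the escape distance `ε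
  -- / 2` is fixed beforehand.
  obtain ⟨θ, ⟨hθ1, hθ2⟩, hθ⟩ : ∃ θ : ℝ, (|θ * k.1| < δ ∧
      |Real.sqrt (M.f r * k.1 ^ 2 / M.g r * (2 * θ + θ ^ 2))| < δ) ∧ 0 < θ := by
    have c1 : Continuous fun θ : ℝ => |θ * k.1| := by fun_prop
    have c2 : Continuous fun θ : ℝ =>
        |Real.sqrt (M.f r * k.1 ^ 2 / M.g r * (2 * θ + θ ^ 2))| := by fun_prop
    have e1 := (c1.tendsto 0).eventually_lt_const (by simpa using hδ : |(0 : ℝ) * k.1| < δ)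
    have e2 := (c2.tendsto 0).eventually_lt_const (by simpa using hδ :
      |Real.sqrt (M.f r * k.1 ^ 2 / M.g r * (2 * 0 + 0 ^ 2))| < δ)
    exact (((e1.and e2).filter_mono nhdsWithin_le_nhds).and self_mem_nhdsWithin :
      ∀ᶠ θ in nhdsWithin (0 : ℝ) (Set.Ioi 0), _).exists
  set v₀ := Real.sqrt (M.f r * k.1 ^ 2 / M.g r * (2 * θ + θ ^ 2)) with hv₀
  have hpos : 0 < M.f r * k.1 ^ 2 / M.g r * (2 * θ + θ ^ 2) := by
    have := sq_pos_of_ne_zero hkt0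
    positivity
  have hv0 : 0 < v₀ := Real.sqrt_pos.2 hpos
  have hv2 : v₀ ^ 2 = M.f r * k.1 ^ 2 / M.g r * (2 * θ + θ ^ 2) := Real.sq_sqrt hpos.le
  obtain ⟨η, a', b', ha', hb', hη, hη0, hηd, τ, hτ, hesc⟩ := exists_escaping_geodesic hε
    (fun x hx => (hball hx).1) (fun x hx => (hball hx).2) hX hU hUU (γ 0).1
    (T₀ := k.1 + θ * k.1) hv0 hκ (by rw [hv2, ← hn]; field_simp; ring)
  have := H η a' b' ha' hb' hη (by rw [hη0]) (by rw [hη0]) (by rw [hηd.deriv, hk.deriv, hkU])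
    (by rw [hη0, hγr 0 h0]; simpa using hδ) (by rw [hηd.deriv, hk.deriv, hk1]; simpa using hθ2)
    (by rw [hηd.deriv, hk.deriv]; simpa using hθ1) τ hτ
  rw [hesc, hγr 0 h0, add_sub_cancel_left, abs_of_pos (by linarith)] at this
  exact lt_irrefl _ this

end StaticSpacetime

/-- A positive second derivative would make `x` a local minimum as well, so `F` would be locally
constant and its second derivative zero. -/
lemma IsLocalMax.deriv_deriv_nonpos {F : ℝ → ℝ} {x : ℝ} (h : IsLocalMax F x)
    (hc : ContinuousAt F x) : deriv (deriv F) x ≤ 0 := by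
  by_contra! hpos
  have hmin := isLocalMin_of_deriv_deriv_pos hpos h.deriv_eq_zero hc
  have hconst : F =ᶠ[nhds x] fun _ => F x := by
    filter_upwards [h, hmin] with y h1 h2 using le_antisymm h1 h2
  have : deriv (deriv F) x = 0 := by
    rw [hconst.deriv.deriv_eq]
    simp
  exact hpos.ne' this

theorem theorem1 (m : ℕ) (M : StaticSpacetime m) (Φ : RadiationFlow M) (hΦ : Φ.IsTransonic)
    (r : ℝ) (hr : Φ.IsSonicRadius r) :
    M.IsUnstablePhotonSurface r ∧
      (deriv (deriv fun x => M.f x / x ^ 2) r ≠ 0 →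
        deriv (deriv fun x => M.f x / x ^ 2) r < 0) := by
  have hrr := Φ.dom_subset hr.1
  have hmax : IsLocalMax (fun x => M.f x / x ^ 2) r := by
    filter_upwards [Φ.isOpen_dom.mem_nhds hr.1] with x hx using hr.isMax hx
  have hcont : ContinuousAt (fun x => M.f x / x ^ 2) r :=
    (StaticSpacetime.differentiableAt_f hrr).continuousAt.div (continuousAt_id.pow 2)
      (pow_ne_zero 2 (M.radii_pos r hrr).ne')
  exact ⟨⟨StaticSpacetime.isPhotonSurface_of_deriv_eq_zero hrr hmax.deriv_eq_zero,
    fun γ a b ha hb hγ hγr =>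
      StaticSpacetime.not_isStableOrbit_of_isLocalMax hrr hmax ha hb hγ hγr⟩,
    fun h => lt_of_le_of_ne (hmax.deriv_deriv_nonpos hcont) h⟩
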